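/- Let $d\ge 2$, let $\Omega\subset\mathbb{R}^d$ be a bounded Lipschitz domain with boundary $\Gamma$, surface measure $dA$ and outward unit normal $\mathbf{n}$, let $\Gamma_D\subseteq\Gamma$ be compact, and let $\gamma$ be a bounded real function on $\Gamma\setminus\Gamma_D$. Let $(\phi_i)_{i\ge1}$ be a complete orthonormal system in $L^2(\Omega)$ of real functions with $-\Delta\phi_i=E_i\phi_i$ in $\Omega$, $E_1\le E_2\le\cdots$, $\phi_i=0$ a.e. on $\Gamma_D$ and $\gamma\phi_i+\partial_n\phi_i=0$ a.e. on $\Gamma\setminus\Gamma_D$. The $\phi_i$ are $C^2$ in $\Omega$ and defined together with their first derivatives up to the boundary, in the following sense: $\phi_i$ and $\nabla\phi_i$ have nontangential limits at almost every point of $\Gamma$ (their boundary values), and their nontangential maximal functions, for every aperture, lie in $L^2(\Gamma)$; for instance, $\phi_i\in C^1(\overline\Omega)$ suffices. With $u_n=\mathbf n\cdot\nabla u$, $u_r=\mathbf r\cdot\nabla u$, $r_n=\mathbf r\cdot\mathbf n$, put $$q(u,v;\mathcal E)=\oint_\Gamma \tfrac{d-2}{2}(u_nv+v_nu)+r_n\bigl(\tfrac{\mathcal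 E}{2}uv-\nabla u\cdot\nabla v\bigr)+u_rv_n+v_ru_n\,dA,\qquad Q_{ij}=q(\phi_i,\phi_j;E_i+E_j).$$ Let $\beta<1/2$ and let $\epsilon_0=\epsilon_0(E)$ satisfy $\epsilon_0=O(E^\beta)$ as $E\to\infty$. For each $E$ let $\tilde Q$ be the submatrix of $Q$ formed by all levels $i,j$ with $E_i,E_j\in[E-\epsilon_0,E+\epsilon_0]$. Then the integrals defining $Q$ converge absolutely, and: 1. $\tilde Q/(2E)\to I$ as $E\to\infty$, in the operator norm (that is, the $\ell^2$ operator norm of $\tilde Q_S/(2E)-I$ tends to $0$, uniformly over all finite sets $S$ of levels in the window; in particular all entries converge uniformly). 2. There is a constant $c_\beta$, depending only on $\Omega$, $\beta$ and the constant $K$ implied in $\epsilon_0=O(E^\beta)$, such that the off-diagonal elements of $\tilde Q/(2E)$ are bounded in absolute value by $c_\beta E^{2\beta-1}$, for every $E>0$ with $\epsilon_0(E)\le KE^\beta$ (in particular for all sufficiently large $E$). -/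

import Mathlib

open Filter Topology Set MeasureTheory

namespace QuasiOrth

noncomputable section

/-- A bounded open set of `ℝ^d` that, near each of its boundary points and after a rigid motion,
is the set of points below the graph of a Lipschitz function of `d - 1` variables. -/
structure IsLipschitzDomain {d : ℕ} (Ω : Set (EuclideanSpace ℝ (Fin d))) : Prop where
  isOpen : IsOpen Ω
  isBounded : Bornology.IsBounded Ω
  local_graph : ∀ p ∈ frontier Ω,
    ∃ (e : EuclideanSpace ℝ (Fin d) ≃ₗᵢ[ℝ] WithLp 2 (EuclideanSpace ℝ (Fin (d - 1)) × ℝ))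
      (ψ : EuclideanSpace ℝ (Fin (d - 1)) → ℝ) (L : NNReal) (ρ : ℝ),
      LipschitzWith L ψ ∧ 0 < ρ ∧
        ∀ x ∈ Metric.ball p ρ, x ∈ Ω ↔ (e x).snd < ψ (e x).fst

/-- The surface measure `dA` on the boundary: the `(d - 1)`-dimensional Hausdorff measure, with
the normalization that agrees with Lebesgue measure on `ℝ^(d-1)`. -/
def surfaceMeasure {d : ℕ} (Ω : Set (EuclideanSpace ℝ (Fin d))) :
    Measure (EuclideanSpace ℝ (Fin d)) :=
  (Measure.euclideanHausdorffMeasure (d - 1)).restrict (frontier Ω)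

/-- `n` is an outward unit normal at `s`: to first order at `s`, the set `Ω` is the half-space
`⟪n, x - s⟫ < 0`. -/
def IsOutwardNormal {d : ℕ} (Ω : Set (EuclideanSpace ℝ (Fin d)))
    (s n : EuclideanSpace ℝ (Fin d)) : Prop :=
  ‖n‖ = 1 ∧ ∀ ε > (0 : ℝ), ∀ᶠ x in 𝓝 s,
    (x ∈ Ω → inner ℝ n (x - s) ≤ ε * ‖x - s‖) ∧
    (x ∉ Ω → -(ε * ‖x - s‖) ≤ inner ℝ n (x - s))

open Classical in
/-- The outward unit normal `𝐧(s)`. It exists (and is unique) at almost every boundary point of a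
Lipschitz domain; the value is `0` where it does not exist. -/
def outwardNormal {d : ℕ} (Ω : Set (EuclideanSpace ℝ (Fin d))) (s : EuclideanSpace ℝ (Fin d)) :
    EuclideanSpace ℝ (Fin d) :=
  if h : ∃ n, IsOutwardNormal Ω s n then h.choose else 0

/-- The nontangential approach region in `Ω` with vertex `s` and aperture `a`. -/
def approachRegion {d : ℕ} (Ω : Set (EuclideanSpace ℝ (Fin d))) (a : ℝ)
    (s : EuclideanSpace ℝ (Fin d)) : Set (EuclideanSpace ℝ (Fin d)) :=
  {x | x ∈ Ω ∧ dist x s < (1 + a) * Metric.infDist x (frontier Ω)}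

/-- `f` has nontangential limit `y` at `s` from within `Ω` (for every aperture). -/
def HasBoundaryValue {d : ℕ} {F : Type*} [TopologicalSpace F]
    (Ω : Set (EuclideanSpace ℝ (Fin d))) (f : EuclideanSpace ℝ (Fin d) → F)
    (s : EuclideanSpace ℝ (Fin d)) (y : F) : Prop :=
  ∀ a > (0 : ℝ), Tendsto f (𝓝[approachRegion Ω a s] s) (𝓝 y)

open Classical in
/-- The boundary value of `f` at `s`, as a nontangential limit from within `Ω`; the value is `0`
where the limit does not exist. -/
def boundaryValue {d : ℕ} {F : Type*} [TopologicalSpace F] [Zero F]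
    (Ω : Set (EuclideanSpace ℝ (Fin d))) (f : EuclideanSpace ℝ (Fin d) → F)
    (s : EuclideanSpace ℝ (Fin d)) : F :=
  if h : ∃ y, HasBoundaryValue Ω f s y then h.choose else 0

/-- `f` is defined up to the boundary in the square-integrable sense: it has a boundary value at
almost every boundary point, and its nontangential maximal functions are square-integrable on the
boundary. Every `f` that extends continuously to the closure of a Lipschitz domain is of this
kind. -/
structure RegularUpToBoundary {d : ℕ} {F : Type*} [NormedAddCommGroup F]
    (Ω : Set (EuclideanSpace ℝ (Fin d))) (f : EuclideanSpace ℝ (Fin d) → F) : Prop where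
  hasBoundaryValue : ∀ᵐ s ∂(surfaceMeasure Ω), ∃ y, HasBoundaryValue Ω f s y
  maximal : ∀ a > (0 : ℝ),
    ∫⁻ s, (⨆ x ∈ approachRegion Ω a s, ‖f x‖ₑ) ^ 2 ∂(surfaceMeasure Ω) < ⊤

/-- The boundary values of `∇u`. -/
def bdryGrad {d : ℕ} (Ω : Set (EuclideanSpace ℝ (Fin d))) (u : EuclideanSpace ℝ (Fin d) → ℝ) :
    EuclideanSpace ℝ (Fin d) → EuclideanSpace ℝ (Fin d) :=
  boundaryValue Ω (gradient u)

/-- The normal derivative `u_n = 𝐧 · ∇u` on the boundary. -/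
def normalDeriv {d : ℕ} (Ω : Set (EuclideanSpace ℝ (Fin d))) (u : EuclideanSpace ℝ (Fin d) → ℝ)
    (s : EuclideanSpace ℝ (Fin d)) : ℝ :=
  inner ℝ (outwardNormal Ω s) (bdryGrad Ω u s)

/-- The radial derivative `u_r = 𝐫 · ∇u` on the boundary. -/
def radialDeriv {d : ℕ} (Ω : Set (EuclideanSpace ℝ (Fin d))) (u : EuclideanSpace ℝ (Fin d) → ℝ)
    (s : EuclideanSpace ℝ (Fin d)) : ℝ :=
  inner ℝ s (bdryGrad Ω u s)

/-- The integrand of the boundary form `q(u, v; 𝓔)`. -/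
def qIntegrand {d : ℕ} (Ω : Set (EuclideanSpace ℝ (Fin d))) (u v : EuclideanSpace ℝ (Fin d) → ℝ)
    (en : ℝ) (s : EuclideanSpace ℝ (Fin d)) : ℝ :=
  ((d : ℝ) - 2) / 2 *
      (normalDeriv Ω u s * boundaryValue Ω v s + normalDeriv Ω v s * boundaryValue Ω u s)
    + inner ℝ s (outwardNormal Ω s) *
      (en / 2 * (boundaryValue Ω u s * boundaryValue Ω v s)
        - inner ℝ (bdryGrad Ω u s) (bdryGrad Ω v s))
    + radialDeriv Ω u s * normalDeriv Ω v s + radialDeriv Ω v s * normalDeriv Ω u s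

/-- The boundary form `q(u, v; 𝓔)`. -/
def q {d : ℕ} (Ω : Set (EuclideanSpace ℝ (Fin d))) (u v : EuclideanSpace ℝ (Fin d) → ℝ)
    (en : ℝ) : ℝ :=
  ∫ s, qIntegrand Ω u v en s ∂(surfaceMeasure Ω)

/-- The semi-infinite matrix `Q_ij = q(φ_i, φ_j; E_i + E_j)`. -/
def Q {d : ℕ} (Ω : Set (EuclideanSpace ℝ (Fin d))) (E : ℕ → ℝ)
    (φ : ℕ → EuclideanSpace ℝ (Fin d) → ℝ) : Matrix ℕ ℕ ℝ :=
  fun i j => q Ω (φ i) (φ j) (E i + E j)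

/-- `φ` is a complete orthonormal sequence of real eigenfunctions of `-Δ` on `Ω`, with eigenvalues
`E` in increasing order, for the Dirichlet condition on the part `ΓD` of the boundary and the
condition `γ φ + ∂ₙφ = 0` on the rest. -/
structure IsEigenSystem {d : ℕ} (Ω ΓD : Set (EuclideanSpace ℝ (Fin d)))
    (γ : EuclideanSpace ℝ (Fin d) → ℝ) (E : ℕ → ℝ)
    (φ : ℕ → EuclideanSpace ℝ (Fin d) → ℝ) : Prop where
  isCompact_dirichlet : IsCompact ΓD
  dirichlet_subset : ΓD ⊆ frontier Ω
  bounded_robin : ∃ M : ℝ, ∀ s ∈ frontier Ω \ ΓD, |γ s| ≤ M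
  contDiffOn : ∀ i, ContDiffOn ℝ 2 (φ i) Ω
  regular : ∀ i, RegularUpToBoundary Ω (φ i)
  regular_gradient : ∀ i, RegularUpToBoundary Ω (gradient (φ i))
  eigen : ∀ i, ∀ x ∈ Ω, -Laplacian.laplacian (φ i) x = E i * φ i x
  dirichlet : ∀ i, ∀ᵐ s ∂(surfaceMeasure Ω), s ∈ ΓD → boundaryValue Ω (φ i) s = 0
  robin : ∀ i, ∀ᵐ s ∂(surfaceMeasure Ω), s ∉ ΓD →
    γ s * boundaryValue Ω (φ i) s + normalDeriv Ω (φ i) s = 0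
  ordered : Monotone E
  orthonormal : ∀ i j, ∫ x in Ω, φ i x * φ j x = if i = j then 1 else 0
  complete : ∀ f : EuclideanSpace ℝ (Fin d) → ℝ, MemLp f 2 (volume.restrict Ω) →
    (∀ i, ∫ x in Ω, f x * φ i x = 0) → f =ᵐ[volume.restrict Ω] 0

/-- The finite submatrix of `A` with rows and columns in `S`. -/
def subMat (A : Matrix ℕ ℕ ℝ) (S : Finset ℕ) : Matrix S S ℝ :=
  fun i j => A i j

/-- The levels whose energy lies in the window `[en - w, en + w]`. -/
def window (E : ℕ → ℝ) (en w : ℝ) : Set ℕ := {i | E i ∈ Icc (en - w) (en + w)}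

end

end QuasiOrth

namespace QuasiOrth

section AreaFormula

open scoped ENNReal NNReal RealInnerProductSpace

/-- The Hausdorff measure of an image, compared with the one of an image under a map which
expands distances at least as much up to the factor `C`. -/
theorem euclideanHausdorffMeasure_image_le_of_dist_le {A X Y : Type*}
    [MetricSpace X] [MeasurableSpace X] [BorelSpace X]
    [MetricSpace Y] [MeasurableSpace Y] [BorelSpace Y]
    {f : A → X} {g : A → Y} {t : Set A} {C : ℝ} (hC : 0 ≤ C)
    (h : ∀ x ∈ t, ∀ y ∈ t, dist (f x) (f y) ≤ C * dist (g x) (g y)) (m : ℕ) :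
    Measure.euclideanHausdorffMeasure m (f '' t) ≤
      ENNReal.ofReal (C ^ m) * Measure.euclideanHausdorffMeasure m (g '' t) := by
  rcases t.eq_empty_or_nonempty with rfl | ⟨x₀, hx₀⟩
  · simp
  have : Nonempty A := ⟨x₀⟩
  set r := Function.invFunOn g t
  have hr : ∀ x ∈ t, r (g x) ∈ t ∧ g (r (g x)) = g x := fun x hx =>
    ⟨Function.invFunOn_mem ⟨x, hx, rfl⟩, Function.invFunOn_eq ⟨x, hx, rfl⟩⟩
  have hL : LipschitzOnWith C.toNNReal (f ∘ r) (g '' t) := by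
    apply LipschitzOnWith.of_dist_le_mul
    rintro _ ⟨x, hx, rfl⟩ _ ⟨y, hy, rfl⟩
    have := h _ (hr x hx).1 _ (hr y hy).1
    rw [(hr x hx).2, (hr y hy).2] at this
    simpa [Real.coe_toNNReal C hC] using this
  have himg : f '' t ⊆ (f ∘ r) '' (g '' t) := by
    rintro _ ⟨x, hx, rfl⟩
    refine ⟨g x, ⟨x, hx, rfl⟩, ?_⟩
    have := h _ (hr x hx).1 _ hx
    rw [(hr x hx).2, dist_self, mul_zero] at this
    exact dist_le_zero.1 this
  have key := (measure_mono himg).trans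
    (hL.hausdorffMeasure_image_le (d := (m : ℝ)) (Nat.cast_nonneg m))
  rw [Measure.euclideanHausdorffMeasure_def, Measure.euclideanHausdorffMeasure_def]
  simp only [Measure.smul_apply, ENNReal.smul_def, smul_eq_mul]
  rw [mul_left_comm]
  gcongr
  refine key.trans_eq ?_
  rw [ENNReal.ofReal_pow hC, ENNReal.rpow_natCast]
  rfl

section AreaElement

variable {V : Type*} [NormedAddCommGroup V]

/-- The area element of the graph of a function with gradient `α`. -/
noncomputable def areaElement (α : V) : ℝ := √(1 + ‖α‖ ^ 2)

theorem one_le_areaElement (α : V) : 1 ≤ areaElement α :=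
  Real.one_le_sqrt.2 (by nlinarith [sq_nonneg ‖α‖])

theorem areaElement_sq (α : V) : areaElement α ^ 2 = 1 + ‖α‖ ^ 2 :=
  Real.sq_sqrt (by positivity)

theorem continuous_areaElement : Continuous (areaElement : V → ℝ) := by
  unfold areaElement; fun_prop

theorem norm_le_areaElement (α : V) : ‖α‖ ≤ areaElement α :=
  Real.le_sqrt_of_sq_le (by linarith)

theorem areaElement_le_add (α β : V) : areaElement α ≤ areaElement β + ‖α - β‖ := by
  apply Real.sqrt_le_iff.2
  refine ⟨by linarith [one_le_areaElement β, norm_nonneg (α - β)], ?_⟩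
  have h1 : ‖α‖ ≤ ‖β‖ + ‖α - β‖ := by
    simpa using norm_add_le β (α - β)
  nlinarith [areaElement_sq β, norm_le_areaElement β, norm_nonneg α, norm_nonneg β,
    norm_nonneg (α - β), mul_le_mul_of_nonneg_right (norm_le_areaElement β) (norm_nonneg (α - β))]

end AreaElement

variable {V : Type*} [NormedAddCommGroup V] [InnerProductSpace ℝ V]

theorem exists_linearMap_norm_sq_eq [FiniteDimensional ℝ V] (α : V) :
    ∃ B : V →ₗ[ℝ] V, (∀ x, ‖B x‖ ^ 2 = ‖x‖ ^ 2 + ⟪α, x⟫ ^ 2) ∧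
      LinearMap.det B = √(1 + ‖α‖ ^ 2) := by
  set J := √(1 + ‖α‖ ^ 2)
  have hJ : J ^ 2 = 1 + ‖α‖ ^ 2 := Real.sq_sqrt (by positivity)
  have hJ0 : 0 ≤ J := Real.sqrt_nonneg _
  have hc : (1 + J)⁻¹ * (1 + J) = 1 := inv_mul_cancel₀ (by positivity)
  set c := (1 + J)⁻¹
  refine ⟨LinearMap.transvection (innerSL ℝ α).toLinearMap (c • α), fun x => ?_, ?_⟩
  · have : (LinearMap.transvection (innerSL ℝ α).toLinearMap (c • α)) x
        = x + (⟪α, x⟫ * c) • α := by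
      simp [LinearMap.transvection.apply, smul_smul]
    rw [this, norm_add_sq_real, inner_smul_right, norm_smul, mul_pow, Real.norm_eq_abs, sq_abs,
      real_inner_comm α x]
    have h2 : ‖α‖ ^ 2 = J ^ 2 - 1 := by linarith
    rw [h2]
    have h3 : 2 * c + c ^ 2 * (J ^ 2 - 1) = 1 := by
      have : c ^ 2 * (J ^ 2 - 1) = (c * (1 + J)) * (c * (1 + J)) - 2 * c * (c * (1 + J)) := by ring
      rw [this, hc]; ring
    linear_combination ⟪α, x⟫ ^ 2 * h3
  · rw [LinearMap.transvection.det]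
    simp only [map_smul, smul_eq_mul, ContinuousLinearMap.coe_coe, innerSL_apply_apply,
      real_inner_self_eq_norm_sq]
    have h2 : ‖α‖ ^ 2 = J ^ 2 - 1 := by linarith
    rw [h2]
    linear_combination (J - 1) * hc

variable [FiniteDimensional ℝ V] [MeasurableSpace V] [BorelSpace V]
  {X : Type*} [MetricSpace X] [MeasurableSpace X] [BorelSpace X]

theorem graph_measure_bounds_of_approx {ψ : V → ℝ} {G : V → X}
    (hG : ∀ x y, dist (G x) (G y) ^ 2 = dist x y ^ 2 + (ψ x - ψ y) ^ 2)
    {t : Set V} {α : V} {δ : ℝ} (hδ : 0 < δ) (hδ1 : δ < 1)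
    (ht : ∀ x ∈ t, ∀ y ∈ t, |ψ x - ψ y - ⟪α, x - y⟫| ≤ δ * ‖x - y‖) :
    Measure.euclideanHausdorffMeasure (Module.finrank ℝ V) (G '' t) ≤
      ENNReal.ofReal ((1 + δ) ^ Module.finrank ℝ V) *
        (ENNReal.ofReal (areaElement α) * volume t) ∧
    ENNReal.ofReal ((1 - δ) ^ Module.finrank ℝ V) *
        (ENNReal.ofReal (areaElement α) * volume t) ≤
      Measure.euclideanHausdorffMeasure (Module.finrank ℝ V) (G '' t) := by
  obtain ⟨B, hB, hdet⟩ := exists_linearMap_norm_sq_eq α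
  have hvol : Measure.euclideanHausdorffMeasure (Module.finrank ℝ V) (B '' t) =
      ENNReal.ofReal (areaElement α) * volume t := by
    rw [InnerProductSpace.euclideanHausdorffMeasure_eq_volume,
      Measure.addHaar_image_linearMap, hdet, abs_of_nonneg (Real.sqrt_nonneg _)]
    rfl
  have hBd : ∀ x y, dist (B x) (B y) ^ 2 = ‖x - y‖ ^ 2 + ⟪α, x - y⟫ ^ 2 := fun x y => by
    rw [dist_eq_norm, ← map_sub, hB]
  have hBl : ∀ x y, ‖x - y‖ ≤ dist (B x) (B y) := fun x y =>
    le_of_sq_le_sq (by nlinarith [hBd x y, sq_nonneg ⟪α, x - y⟫]) dist_nonneg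
  -- both distances are Euclidean norms of pairs differing by at most `δ * ‖x - y‖`
  have tri : ∀ a p r D D' : ℝ, 0 ≤ D → 0 ≤ D' → D ^ 2 = a ^ 2 + p ^ 2 → D' ^ 2 = a ^ 2 + r ^ 2 →
      D ≤ D' + |p - r| := by
    intro a p r D D' h0 h0' h h'
    have hr : |r| ≤ D' := abs_le_of_sq_le_sq (by nlinarith [sq_nonneg a]) h0'
    apply le_of_sq_le_sq _ (by positivity)
    have e1 : (p - r) ^ 2 = |p - r| ^ 2 := (sq_abs _).symm
    have e2 : r * (p - r) ≤ |r| * |p - r| := by rw [← abs_mul]; exact le_abs_self _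
    nlinarith [mul_le_mul_of_nonneg_right hr (abs_nonneg (p - r))]
  constructor
  · rw [← hvol]
    refine euclideanHausdorffMeasure_image_le_of_dist_le (by linarith) (fun x hx y hy => ?_) _
    have h1 := tri ‖x - y‖ (ψ x - ψ y) ⟪α, x - y⟫ _ _ dist_nonneg dist_nonneg
      (by rw [hG, dist_eq_norm]) (hBd x y)
    have h2 := ht x hx y hy
    nlinarith [hBl x y]
  · rw [← hvol]
    have h0 : 0 < 1 - δ := by linarith
    have key : Measure.euclideanHausdorffMeasure (Module.finrank ℝ V) (B '' t) ≤
        ENNReal.ofReal (((1 - δ)⁻¹) ^ Module.finrank ℝ V) *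
        Measure.euclideanHausdorffMeasure (Module.finrank ℝ V) (G '' t) := by
      refine euclideanHausdorffMeasure_image_le_of_dist_le (by positivity)
        (fun x hx y hy => ?_) _
      have h1 := tri ‖x - y‖ ⟪α, x - y⟫ (ψ x - ψ y) _ _ dist_nonneg dist_nonneg
        (hBd x y) (by rw [hG, dist_eq_norm])
      have h2 := ht x hx y hy
      rw [abs_sub_comm] at h1
      rw [inv_mul_eq_div, le_div_iff₀ h0]
      nlinarith [hBl x y]
    calc _ ≤ ENNReal.ofReal ((1 - δ) ^ Module.finrank ℝ V) *
        (ENNReal.ofReal (((1 - δ)⁻¹) ^ Module.finrank ℝ V) *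
        Measure.euclideanHausdorffMeasure (Module.finrank ℝ V) (G '' t)) := by gcongr
      _ = _ := by
        rw [← mul_assoc, ← ENNReal.ofReal_mul (by positivity), ← mul_pow,
          mul_inv_cancel₀ h0.ne', one_pow, ENNReal.ofReal_one, one_mul]

theorem measure_le_of_iUnion_eq {A : Type*} [MeasurableSpace A] {μ ν : Measure A}
    {s : ℕ → Set A} (hs : ∀ n, MeasurableSet (s n)) {t : Set A} (ht : MeasurableSet t)
    (hts : t ⊆ ⋃ n, s n)
    (h : ∀ n, ∀ a ⊆ s n, MeasurableSet a → a ⊆ t → ν a ≤ μ a) : ν t ≤ μ t := by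
  have hd : t = ⋃ n, t ∩ disjointed s n := by
    rw [← inter_iUnion, iUnion_disjointed, inter_eq_left.2 hts]
  have hm : ∀ n, MeasurableSet (t ∩ disjointed s n) := fun n =>
    ht.inter (MeasurableSet.disjointed hs n)
  have hdj : Pairwise (Function.onFun Disjoint fun n => t ∩ disjointed s n) := fun i j hij =>
    (disjoint_disjointed s hij).mono inter_subset_right inter_subset_right
  rw [hd, measure_iUnion hdj hm, measure_iUnion hdj hm]
  exact ENNReal.tsum_le_tsum fun n => h n _ (inter_subset_right.trans (disjointed_subset s n))
    (hm n) inter_subset_left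

theorem measurable_gradient {ψ : V → ℝ} : Measurable (gradient ψ) := by
  unfold gradient
  exact (LinearIsometryEquiv.continuous _).measurable.comp (measurable_fderiv ℝ ψ)

/-- The graph parametrization `G` of a Lipschitz function `ψ` transports the measure with density
`√(1 + ‖∇ψ‖²)` to the Hausdorff measure. -/
theorem comap_graph_eq_withDensity {ψ : V → ℝ} {L : ℝ≥0} (hψ : LipschitzWith L ψ) {G : V → X}
    (hG : ∀ x y, dist (G x) (G y) ^ 2 = dist x y ^ 2 + (ψ x - ψ y) ^ 2)
    (hGm : MeasurableEmbedding G) :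
    (Measure.euclideanHausdorffMeasure (Module.finrank ℝ V)).comap G =
      volume.withDensity fun x => ENNReal.ofReal (areaElement (gradient ψ x)) := by
  set m := Module.finrank ℝ V
  set ν := (Measure.euclideanHausdorffMeasure m : Measure X).comap G with hν
  set μ : Measure V := volume.withDensity fun x => ENNReal.ofReal (areaElement (gradient ψ x))
    with hμ
  have hνap : ∀ a, ν a = Measure.euclideanHausdorffMeasure m (G '' a) := fun a =>
    hGm.comap_apply _ a
  have hνnull : ∀ a, volume a = 0 → ν a = 0 := by
    intro a ha
    rw [hνap]
    have hle := euclideanHausdorffMeasure_image_le_of_dist_le (f := G) (g := (id : V → V)) (t := a)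
      (C := 1 + L) (by positivity) (fun x _ y _ => ?_) m
    · rw [image_id, InnerProductSpace.euclideanHausdorffMeasure_eq_volume, ha, mul_zero] at hle
      exact le_antisymm hle bot_le
    · apply le_of_sq_le_sq _ (by positivity)
      rw [hG]
      have h1 : |ψ x - ψ y| ≤ L * dist x y := by
        rw [← Real.dist_eq]; exact hψ.dist_le_mul x y
      have h2 : (ψ x - ψ y) ^ 2 ≤ (L * dist x y) ^ 2 := by
        rw [← sq_abs]; gcongr
      simp only [id]
      nlinarith [mul_nonneg (NNReal.coe_nonneg L) (sq_nonneg (dist x y))]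
  have hμnull : ∀ a, volume a = 0 → μ a = 0 := fun a ha =>
    withDensity_absolutelyContinuous _ _ ha
  set D := {x | DifferentiableAt ℝ ψ x}
  have hDm : MeasurableSet D := measurableSet_of_differentiableAt ℝ ψ
  have hDae : volume Dᶜ = 0 := hψ.ae_differentiableAt
  -- comparison up to a factor close to one
  have main : ∀ δ : ℝ, 0 < δ → δ < 1 → ∀ a, MeasurableSet a →
      ν a ≤ ENNReal.ofReal ((1 + δ) ^ (m + 1)) * μ a ∧
      ENNReal.ofReal ((1 - δ) ^ (m + 1)) * μ a ≤ ν a := by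
    intro δ hδ hδ1
    obtain ⟨q, hq⟩ := TopologicalSpace.exists_dense_seq V
    set s : ℕ → Set V := fun k => D ∩ gradient ψ ⁻¹' (Metric.ball (q k) (δ / 2)) with hs
    have hsm : ∀ k, MeasurableSet (s k) := fun k =>
      hDm.inter (measurable_gradient measurableSet_ball)
    have hgr : ∀ x ∈ D, HasFDerivAt ψ (innerSL ℝ (gradient ψ x)) x := fun x hx =>
      (hx : DifferentiableAt ℝ ψ x).hasGradientAt.hasFDerivAt
    have hsD : D ⊆ ⋃ k, s k := by
      intro x hx
      obtain ⟨k, hk⟩ := hq.exists_dist_lt (gradient ψ x) (half_pos hδ)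
      exact mem_iUnion.2 ⟨k, hx, hk⟩
    -- on each piece
    have piece : ∀ k, ∃ t : ℕ → Set V, (∀ n, MeasurableSet (t n)) ∧ s k ⊆ ⋃ n, t n ∧
        ∀ n, ∀ a ⊆ t n, MeasurableSet a → a ⊆ s k →
          ν a ≤ ENNReal.ofReal ((1 + δ) ^ (m + 1)) * μ a ∧
          ENNReal.ofReal ((1 - δ) ^ (m + 1)) * μ a ≤ ν a := by
      intro k
      rcases (s k).eq_empty_or_nonempty with hke | hne
      · refine ⟨fun _ => ∅, by simp, by simp [hke], fun n a ha _ _ => ?_⟩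
        obtain rfl : a = ∅ := subset_empty_iff.1 ha
        simp
      obtain ⟨t, A, -, htm, hst, hap, hA⟩ :=
        exists_partition_approximatesLinearOn_of_hasFDerivWithinAt ψ (s k)
          (fun x => innerSL ℝ (gradient ψ x)) (fun x hx => (hgr x hx.1).hasFDerivWithinAt)
          (fun _ => δ.toNNReal) (fun _ => by simpa using hδ)
      refine ⟨t, htm, hst, fun n a hat ham has => ?_⟩
      obtain ⟨y, hy, hAy⟩ := hA hne n
      set α := gradient ψ y
      have happ : ∀ u ∈ a, ∀ v ∈ a, |ψ u - ψ v - ⟪α, u - v⟫| ≤ δ * ‖u - v‖ := by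
        intro u hu v hv
        have := hap n u ⟨has hu, hat hu⟩ v ⟨has hv, hat hv⟩
        rw [hAy, Real.coe_toNNReal δ hδ.le] at this
        simpa [Real.norm_eq_abs] using this
      obtain ⟨hup, hlo⟩ := graph_measure_bounds_of_approx hG hδ hδ1 happ
      have hclose : ∀ x ∈ a, ‖α - gradient ψ x‖ ≤ δ := by
        intro x hx
        have h1 : dist α (q k) < δ / 2 := hy.2
        have h2 : dist (gradient ψ x) (q k) < δ / 2 := (has hx).2
        rw [← dist_eq_norm]
        linarith [dist_triangle_right α (gradient ψ x) (q k)]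
      have hJ : ∀ x ∈ a, areaElement α ≤ (1 + δ) * areaElement (gradient ψ x) ∧
          (1 - δ) * areaElement (gradient ψ x) ≤ areaElement α := by
        intro x hx
        have h1 := hclose x hx
        have h2 := areaElement_le_add α (gradient ψ x)
        have h3 := areaElement_le_add (gradient ψ x) α
        rw [norm_sub_rev] at h3
        have h4 := one_le_areaElement (gradient ψ x)
        constructor <;> nlinarith
      have hμa : μ a = ∫⁻ x in a, ENNReal.ofReal (areaElement (gradient ψ x)) :=
        withDensity_apply _ ham
      have hconst : ENNReal.ofReal (areaElement α) * volume a
          = ∫⁻ _ in a, ENNReal.ofReal (areaElement α) := by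
        rw [setLIntegral_const]
      have hmeas : Measurable fun x => ENNReal.ofReal (areaElement (gradient ψ x)) :=
        (continuous_areaElement.measurable.comp measurable_gradient).ennreal_ofReal
      rw [hνap]
      have h1δ : 0 < 1 - δ := by linarith
      constructor
      · refine hup.trans ?_
        rw [pow_succ, ENNReal.ofReal_mul (by positivity), mul_assoc]
        gcongr ENNReal.ofReal _ * ?_
        rw [hconst, hμa, ← lintegral_const_mul _ hmeas]
        refine setLIntegral_mono' ham fun x hx => ?_
        rw [← ENNReal.ofReal_mul (by positivity)]
        exact ENNReal.ofReal_le_ofReal (hJ x hx).1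
      · refine le_trans ?_ hlo
        rw [pow_succ, ENNReal.ofReal_mul (by positivity), mul_assoc]
        gcongr ENNReal.ofReal _ * ?_
        rw [hconst, hμa, ← lintegral_const_mul _ hmeas]
        refine setLIntegral_mono' ham fun x hx => ?_
        rw [← ENNReal.ofReal_mul (by positivity)]
        exact ENNReal.ofReal_le_ofReal (hJ x hx).2
    choose t htm hst hb using piece
    intro a ham
    have hsplit : ∀ (κ : Measure V), (∀ a, volume a = 0 → κ a = 0) → κ a = κ (a ∩ D) := by
      intro κ hκ
      rw [← measure_inter_add_sdiff a hDm, hκ (a \ D), add_zero]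
      exact measure_mono_null (fun x hx => hx.2) hDae
    have hsub : a ∩ D ⊆ ⋃ k, s k := inter_subset_right.trans hsD
    rw [hsplit ν hνnull, hsplit μ hμnull]
    have e1 : ∀ (c : ℝ≥0∞) b, c * μ b = (c • μ) b := fun c b => by simp
    constructor
    · rw [e1]
      refine measure_le_of_iUnion_eq hsm (ham.inter hDm) hsub fun k b hbs hbm _ => ?_
      refine measure_le_of_iUnion_eq (htm k) hbm (hbs.trans (hst k)) fun n c hct hcm hcb => ?_
      rw [← e1]
      exact (hb k n c hct hcm (hcb.trans hbs)).1
    · rw [e1]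
      refine measure_le_of_iUnion_eq hsm (ham.inter hDm) hsub fun k b hbs hbm _ => ?_
      refine measure_le_of_iUnion_eq (htm k) hbm (hbs.trans (hst k)) fun n c hct hcm hcb => ?_
      rw [← e1]
      exact (hb k n c hct hcm (hcb.trans hbs)).2
  ext a ham
  have hev : ∀ᶠ δ : ℝ in 𝓝[>] 0, 0 < δ ∧ δ < 1 :=
    Ioo_mem_nhdsGT one_pos
  have lim : ∀ σ : ℝ, Tendsto (fun δ : ℝ => ENNReal.ofReal ((1 + σ * δ) ^ (m + 1)) * μ a)
      (𝓝[>] 0) (𝓝 (μ a)) := by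
    intro σ
    have h1 : Tendsto (fun δ : ℝ => ENNReal.ofReal ((1 + σ * δ) ^ (m + 1))) (𝓝[>] 0) (𝓝 1) := by
      have : Continuous fun δ : ℝ => ENNReal.ofReal ((1 + σ * δ) ^ (m + 1)) :=
        ENNReal.continuous_ofReal.comp (by fun_prop)
      have := this.tendsto 0
      simp only [mul_zero, add_zero, one_pow, ENNReal.ofReal_one] at this
      exact this.mono_left nhdsWithin_le_nhds
    have := ENNReal.Tendsto.mul_const (b := μ a) h1 (Or.inl one_ne_zero)
    simpa using this
  apply le_antisymm
  · refine ge_of_tendsto (lim 1) (hev.mono fun δ hδ => ?_)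
    simpa using (main δ hδ.1 hδ.2 a ham).1
  · refine le_of_tendsto (lim (-1)) (hev.mono fun δ hδ => ?_)
    simpa [sub_eq_add_neg] using (main δ hδ.1 hδ.2 a ham).2

end AreaFormula

end QuasiOrth

namespace QuasiOrth

section Subgraph

open scoped ENNReal NNReal RealInnerProductSpace

variable {V : Type*} [NormedAddCommGroup V]

/-- The shear `(x, s) ↦ (x, ψ x + s)`, which flattens the subgraph of `ψ`. -/
def shearHomeomorph {ψ : V → ℝ} (hψ : Continuous ψ) : V × ℝ ≃ₜ V × ℝ where
  toFun p := (p.1, ψ p.1 + p.2)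
  invFun p := (p.1, p.2 - ψ p.1)
  left_inv p := by simp
  right_inv p := by simp
  continuous_toFun := by fun_prop
  continuous_invFun := by fun_prop

@[simp] theorem shearHomeomorph_apply {ψ : V → ℝ} (hψ : Continuous ψ) (p : V × ℝ) :
    shearHomeomorph hψ p = (p.1, ψ p.1 + p.2) := rfl

variable [InnerProductSpace ℝ V] [FiniteDimensional ℝ V] [MeasurableSpace V] [BorelSpace V]

theorem measurePreserving_shearHomeomorph {ψ : V → ℝ} (hψ : Continuous ψ) :
    MeasurePreserving (shearHomeomorph hψ) (volume : Measure (V × ℝ)) volume := by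
  refine MeasurePreserving.skew_product (g := fun x s => ψ x + s) (MeasurePreserving.id _)
    (by fun_prop) (ae_of_all _ fun x => ?_)
  exact (measurePreserving_add_left volume (ψ x)).map_eq

theorem integral_lineDeriv_eq_zero {k : V → ℝ} {C : ℝ≥0} (hk : LipschitzWith C k)
    (hc : HasCompactSupport k) (v : V) : ∫ x, lineDeriv ℝ k x v = 0 := by
  have h := LipschitzWith.integral_lineDeriv_mul_eq (μ := (volume : Measure V))
    (LipschitzWith.const (1 : ℝ) : LipschitzWith 0 fun _ : V => (1 : ℝ)) hk hc (-v)
  simpa [lineDeriv] using h.symm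

/-- The divergence theorem for a constant direction on the subgraph of a Lipschitz function. -/
theorem integral_fderiv_subgraph {ψ : V → ℝ} {L : ℝ≥0} (hψ : LipschitzWith L ψ)
    {g : V × ℝ → ℝ} (hg : ContDiff ℝ 1 g) (hgc : HasCompactSupport g) (v : V) (c : ℝ) :
    ∫ p in {p : V × ℝ | p.2 < ψ p.1}, fderiv ℝ g p (v, c) =
      ∫ x, (c - fderiv ℝ ψ x v) * g (x, ψ x) := by
  set T := shearHomeomorph hψ.continuous with hT
  have hpre : T ⁻¹' {p : V × ℝ | p.2 < ψ p.1} = univ ×ˢ Iio (0 : ℝ) := by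
    ext p; simp [hT]
  rw [← (measurePreserving_shearHomeomorph hψ.continuous).setIntegral_preimage_emb
    T.measurableEmbedding, hpre]
  have hdc : ∀ w : V × ℝ, Continuous fun p => fderiv ℝ g p w := fun w =>
    (hg.continuous_fderiv one_ne_zero).clm_apply continuous_const
  have hds : ∀ w : V × ℝ, HasCompactSupport fun p => fderiv ℝ g p w := fun w =>
    (hgc.fderiv ℝ).comp_left (g := fun l : V × ℝ →L[ℝ] ℝ => l w) rfl
  have hint : ∀ w : V × ℝ, Integrable (fun q => fderiv ℝ g (T q) w) := fun w =>
    ((hdc w).comp T.continuous).integrable_of_hasCompactSupport ((hds w).comp_homeomorph T)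
  have hψm : Measurable fun x => fderiv ℝ ψ x v := measurable_fderiv_apply_const ℝ ψ v
  set b : V → ℝ := fun x => c - fderiv ℝ ψ x v
  have hbm : Measurable b := measurable_const.sub hψm
  have hbb : ∀ x, ‖b x‖ ≤ |c| + L * ‖v‖ := fun x => by
    have h1 : ‖fderiv ℝ ψ x v‖ ≤ L * ‖v‖ :=
      (ContinuousLinearMap.le_opNorm _ _).trans
        (mul_le_mul_of_nonneg_right (norm_fderiv_le_of_lipschitz ℝ hψ) (norm_nonneg _))
    exact (norm_sub_le _ _).trans (add_le_add le_rfl h1)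
  have hB : Integrable (fun q : V × ℝ => b q.1 * fderiv ℝ g (T q) (0, 1)) :=
    (hint (0, 1)).bdd_mul (hbm.comp measurable_fst).aestronglyMeasurable
      (ae_of_all _ fun q => hbb q.1)
  have hdecomp : ∀ q : V × ℝ, fderiv ℝ g (T q) (v, c) =
      fderiv ℝ g (T q) (v, fderiv ℝ ψ q.1 v) + b q.1 * fderiv ℝ g (T q) (0, 1) := by
    intro q
    rw [← smul_eq_mul, ← map_smul, ← map_add]
    simp [b]
  have hA : Integrable (fun q : V × ℝ => fderiv ℝ g (T q) (v, fderiv ℝ ψ q.1 v)) := by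
    refine ((hint (v, c)).sub hB).congr (ae_of_all _ fun q => ?_)
    simp only [Pi.sub_apply, hdecomp q]; ring
  refine (integral_congr_ae (ae_of_all _ hdecomp)).trans ?_
  rw [integral_add hA.integrableOn hB.integrableOn, Measure.volume_eq_prod, ← Measure.prod_restrict,
    Measure.restrict_univ]
  have hAr : Integrable (fun q : V × ℝ => fderiv ℝ g (T q) (v, fderiv ℝ ψ q.1 v))
      ((volume : Measure V).prod (volume.restrict (Iio (0 : ℝ)))) := by
    have := hA.integrableOn (s := univ ×ˢ Iio (0 : ℝ))
    rwa [IntegrableOn, Measure.volume_eq_prod, ← Measure.prod_restrict, Measure.restrict_univ]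
      at this
  have hBr : Integrable (fun q : V × ℝ => b q.1 * fderiv ℝ g (T q) (0, 1))
      ((volume : Measure V).prod (volume.restrict (Iio (0 : ℝ)))) := by
    have := hB.integrableOn (s := univ ×ˢ Iio (0 : ℝ))
    rwa [IntegrableOn, Measure.volume_eq_prod, ← Measure.prod_restrict, Measure.restrict_univ]
      at this
  have hgd : ∀ p, DifferentiableAt ℝ g p := fun p => hg.differentiable one_ne_zero p
  obtain ⟨C, hC⟩ := hg.lipschitzWith_of_hasCompactSupport hgc one_ne_zero
  have hAz : ∫ q : V × ℝ, fderiv ℝ g (T q) (v, fderiv ℝ ψ q.1 v)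
      ∂((volume : Measure V).prod (volume.restrict (Iio (0 : ℝ)))) = 0 := by
    rw [integral_prod_symm _ hAr]
    refine integral_eq_zero_of_ae (ae_of_all _ fun s => ?_)
    have hk : LipschitzWith (C * max 1 (L + 0)) fun x => g (x, ψ x + s) :=
      hC.comp (LipschitzWith.id.prodMk (hψ.add (LipschitzWith.const s)))
    have hkc : HasCompactSupport fun x => g (x, ψ x + s) := by
      refine HasCompactSupport.intro (hgc.image continuous_fst) fun x hx => ?_
      by_contra h
      exact hx ⟨_, subset_tsupport _ h, rfl⟩
    change ∫ x, fderiv ℝ g (x, ψ x + s) (v, fderiv ℝ ψ x v) = 0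
    rw [← integral_lineDeriv_eq_zero hk hkc v]
    refine integral_congr_ae ?_
    filter_upwards [hψ.ae_differentiableAt] with x hx
    have h1 : HasFDerivAt (fun x => (x, ψ x + s))
        ((ContinuousLinearMap.id ℝ V).prod (fderiv ℝ ψ x)) x :=
      (hasFDerivAt_id x).prodMk (hx.hasFDerivAt.add_const s)
    have h2 := (hgd (x, ψ x + s)).hasFDerivAt.comp x h1
    have := (h2.hasLineDerivAt v).lineDeriv
    exact this.symm
  rw [hAz, zero_add, integral_prod _ hBr]
  refine integral_congr_ae (ae_of_all _ fun x => ?_)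
  simp only [integral_const_mul]
  congr 1
  have hu : ContDiff ℝ 1 fun s : ℝ => g (x, ψ x + s) :=
    hg.comp (contDiff_const.prodMk (contDiff_const.add contDiff_id))
  have huc : HasCompactSupport fun s : ℝ => g (x, ψ x + s) := by
    refine HasCompactSupport.intro
      ((hgc.image continuous_snd).image (continuous_sub_right (ψ x))) fun s hs => ?_
    by_contra h
    exact hs ⟨ψ x + s, ⟨_, subset_tsupport _ h, rfl⟩, by simp⟩
  have := huc.integral_Iic_deriv_eq hu 0
  rw [add_zero] at this
  rw [← this, integral_Iic_eq_integral_Iio]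
  refine integral_congr_ae (ae_of_all _ fun s => ?_)
  have h1 : HasDerivAt (fun s : ℝ => (x, ψ x + s)) ((0 : V), (1 : ℝ)) s :=
    (hasDerivAt_const s x).prodMk ((hasDerivAt_id s).const_add _)
  exact ((hgd (x, ψ x + s)).hasFDerivAt.comp_hasDerivAt s h1).deriv.symm

end Subgraph

end QuasiOrth

namespace QuasiOrth

open scoped ENNReal NNReal RealInnerProductSpace

variable {d : ℕ} {Ω : Set (EuclideanSpace ℝ (Fin d))} {p : EuclideanSpace ℝ (Fin d)}

/-- Coordinates near a boundary point `p` in which `Ω` is the subgraph of a Lipschitz function. -/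
structure GraphChart (Ω : Set (EuclideanSpace ℝ (Fin d))) (p : EuclideanSpace ℝ (Fin d)) where
  e : EuclideanSpace ℝ (Fin d) ≃ₗᵢ[ℝ] WithLp 2 (EuclideanSpace ℝ (Fin (d - 1)) × ℝ)
  ψ : EuclideanSpace ℝ (Fin (d - 1)) → ℝ
  L : ℝ≥0
  ρ : ℝ
  lipschitz : LipschitzWith L ψ
  ρ_pos : 0 < ρ
  mem_iff : ∀ x ∈ Metric.ball p ρ, x ∈ Ω ↔ (e x).snd < ψ (e x).fst
  isOpen : IsOpen Ω
  mem_frontier : p ∈ frontier Ω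

theorem IsLipschitzDomain.exists_graphChart (hΩ : IsLipschitzDomain Ω) (hp : p ∈ frontier Ω) :
    Nonempty (GraphChart Ω p) := by
  obtain ⟨e, ψ, L, ρ, h1, h2, h3⟩ := hΩ.local_graph p hp
  exact ⟨⟨e, ψ, L, ρ, h1, h2, h3, hΩ.isOpen, hp⟩⟩

namespace GraphChart

variable (c : GraphChart Ω p)

/-- The coordinate map from `ℝ^(d-1) × ℝ`. -/
noncomputable def coord : (EuclideanSpace ℝ (Fin (d - 1)) × ℝ) ≃L[ℝ] EuclideanSpace ℝ (Fin d) :=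
  (WithLp.prodContinuousLinearEquiv 2 ℝ (EuclideanSpace ℝ (Fin (d - 1))) ℝ).symm.trans
    c.e.symm.toContinuousLinearEquiv

theorem coord_apply (q : EuclideanSpace ℝ (Fin (d - 1)) × ℝ) :
    c.coord q = c.e.symm (WithLp.toLp 2 q) := rfl

theorem e_coord (q : EuclideanSpace ℝ (Fin (d - 1)) × ℝ) : c.e (c.coord q) = WithLp.toLp 2 q := by
  simp [coord_apply]

theorem coord_symm_apply (x : EuclideanSpace ℝ (Fin d)) :
    c.coord.symm x = ((c.e x).fst, (c.e x).snd) := rfl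

theorem measurePreserving_coord : MeasurePreserving c.coord :=
  c.e.symm.measurePreserving.comp
    (WithLp.volume_preserving_toLp (U := EuclideanSpace ℝ (Fin (d - 1))) (V := ℝ))

theorem inner_coord (q r : EuclideanSpace ℝ (Fin (d - 1)) × ℝ) :
    ⟪c.coord q, c.coord r⟫ = ⟪q.1, r.1⟫ + q.2 * r.2 := by
  rw [coord_apply, coord_apply, LinearIsometryEquiv.inner_map_map, WithLp.prod_inner_apply]
  simp [mul_comm]

theorem norm_coord_sq (q : EuclideanSpace ℝ (Fin (d - 1)) × ℝ) :
    ‖c.coord q‖ ^ 2 = ‖q.1‖ ^ 2 + q.2 ^ 2 := by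
  rw [← real_inner_self_eq_norm_sq, inner_coord, real_inner_self_eq_norm_sq]; ring

theorem dist_coord_sq (q r : EuclideanSpace ℝ (Fin (d - 1)) × ℝ) :
    dist (c.coord q) (c.coord r) ^ 2 = dist q.1 r.1 ^ 2 + (q.2 - r.2) ^ 2 := by
  rw [dist_eq_norm, ← map_sub, norm_coord_sq, dist_eq_norm]; rfl

theorem dist_fst_le (q r : EuclideanSpace ℝ (Fin (d - 1)) × ℝ) :
    dist q.1 r.1 ≤ dist (c.coord q) (c.coord r) :=
  le_of_sq_le_sq (by nlinarith [c.dist_coord_sq q r, sq_nonneg (q.2 - r.2)]) dist_nonneg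

theorem abs_snd_sub_le (q r : EuclideanSpace ℝ (Fin (d - 1)) × ℝ) :
    |q.2 - r.2| ≤ dist (c.coord q) (c.coord r) :=
  abs_le_of_sq_le_sq (by nlinarith [c.dist_coord_sq q r, sq_nonneg (dist q.1 r.1)]) dist_nonneg

/-- The point at height `s` above the graph, over the base point `x`. -/
noncomputable def pt (x : EuclideanSpace ℝ (Fin (d - 1))) (s : ℝ) : EuclideanSpace ℝ (Fin d) :=
  c.coord (x, c.ψ x + s)

/-- The parametrization of the graph. -/
noncomputable def graph (x : EuclideanSpace ℝ (Fin (d - 1))) : EuclideanSpace ℝ (Fin d) :=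
  c.pt x 0

theorem continuous_pt : Continuous fun q : EuclideanSpace ℝ (Fin (d - 1)) × ℝ => c.pt q.1 q.2 := by
  have := c.lipschitz.continuous
  unfold pt; fun_prop

theorem continuous_pt_left (s : ℝ) : Continuous fun x => c.pt x s :=
  c.continuous_pt.comp (continuous_id.prodMk continuous_const)

theorem continuous_pt_right (x : EuclideanSpace ℝ (Fin (d - 1))) : Continuous (c.pt x) :=
  c.continuous_pt.comp (continuous_const.prodMk continuous_id)

theorem continuous_graph : Continuous c.graph := c.continuous_pt_left 0

theorem dist_graph_sq (x y : EuclideanSpace ℝ (Fin (d - 1))) :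
    dist (c.graph x) (c.graph y) ^ 2 = dist x y ^ 2 + (c.ψ x - c.ψ y) ^ 2 := by
  simp [graph, pt, dist_coord_sq]

theorem dist_pt_graph (x : EuclideanSpace ℝ (Fin (d - 1))) (s : ℝ) :
    dist (c.pt x s) (c.graph x) = |s| := by
  have h := c.dist_coord_sq (x, c.ψ x + s) (x, c.ψ x + 0)
  simp only [dist_self, add_zero, add_sub_cancel_left] at h
  rw [← abs_of_nonneg (dist_nonneg (x := c.pt x s)), ← sq_eq_sq_iff_abs_eq_abs, graph, pt, pt,
    add_zero, h]
  ring

theorem graph_injective : Function.Injective c.graph := fun x y h => by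
  have h1 := c.dist_fst_le (x, c.ψ x + 0) (y, c.ψ y + 0)
  have h2 : dist (c.graph x) (c.graph y) = 0 := by rw [h, dist_self]
  exact dist_le_zero.1 (h1.trans h2.le)

theorem measurableEmbedding_graph : MeasurableEmbedding c.graph :=
  c.continuous_graph.measurableEmbedding c.graph_injective

theorem exists_eq_pt (x : EuclideanSpace ℝ (Fin d)) :
    c.pt (c.e x).fst ((c.e x).snd - c.ψ (c.e x).fst) = x := by
  rw [pt, add_sub_cancel, ← coord_symm_apply, ContinuousLinearEquiv.apply_symm_apply]

theorem pt_mem_iff {x : EuclideanSpace ℝ (Fin (d - 1))} {s : ℝ}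
    (h : c.pt x s ∈ Metric.ball p c.ρ) : c.pt x s ∈ Ω ↔ s < 0 := by
  rw [c.mem_iff _ h, pt, e_coord]
  change c.ψ x + s < c.ψ x ↔ s < 0
  constructor <;> intro h <;> linarith

theorem pt_mem_frontier_iff {x : EuclideanSpace ℝ (Fin (d - 1))} {s : ℝ}
    (h : c.pt x s ∈ Metric.ball p c.ρ) : c.pt x s ∈ frontier Ω ↔ s = 0 := by
  have hev : ∀ᶠ z in 𝓝 (c.pt x s), z ∈ Metric.ball p c.ρ := Metric.isOpen_ball.mem_nhds h
  have hline : ∀ᶠ r in 𝓝 s, c.pt x r ∈ Metric.ball p c.ρ :=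
    (c.continuous_pt_right x).continuousAt.eventually hev
  rw [c.isOpen.frontier_eq, Set.mem_sdiff, c.pt_mem_iff h]
  constructor
  · rintro ⟨hcl, hs⟩
    by_contra hne
    have hpos : 0 < s := lt_of_le_of_ne (not_lt.1 hs) (Ne.symm hne)
    have hcont : Continuous fun z => (c.e z).snd - c.ψ (c.e z).fst := by
      have h1 := c.coord.symm.continuous
      have h2 := c.lipschitz.continuous
      exact h1.snd.sub (h2.comp h1.fst)
    have hval : (c.e (c.pt x s)).snd - c.ψ (c.e (c.pt x s)).fst = s := by
      rw [pt, e_coord]; exact add_sub_cancel_left _ _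
    have h3 : ∀ᶠ z in 𝓝 (c.pt x s), 0 < (c.e z).snd - c.ψ (c.e z).fst :=
      hcont.continuousAt.eventually (lt_mem_nhds (hpos.trans_eq hval.symm))
    obtain ⟨z, hz, hz2⟩ := mem_closure_iff_nhds.1 hcl _ (hev.and h3)
    have := (c.mem_iff z hz.1).1 hz2
    linarith [hz.2]
  · rintro rfl
    refine ⟨?_, lt_irrefl _⟩
    refine mem_closure_of_tendsto (f := c.pt x) (b := 𝓝[<] 0)
      ((c.continuous_pt_right x).continuousAt.tendsto.mono_left nhdsWithin_le_nhds) ?_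
    filter_upwards [nhdsWithin_le_nhds hline, self_mem_nhdsWithin] with r hr hr0
    exact (c.pt_mem_iff hr).2 hr0

theorem graph_mem_frontier {x : EuclideanSpace ℝ (Fin (d - 1))}
    (h : c.graph x ∈ Metric.ball p c.ρ) : c.graph x ∈ frontier Ω :=
  (c.pt_mem_frontier_iff h).2 rfl

theorem mem_range_graph {z : EuclideanSpace ℝ (Fin d)} (hz : z ∈ Metric.ball p c.ρ)
    (hf : z ∈ frontier Ω) : ∃ x, c.graph x = z := by
  refine ⟨(c.e z).fst, ?_⟩
  have h := c.exists_eq_pt z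
  rw [← h] at hz hf
  rw [(c.pt_mem_frontier_iff hz).1 hf] at h
  exact h

/-- The base measure with the density of surface area. -/
noncomputable def baseMeasure : Measure (EuclideanSpace ℝ (Fin (d - 1))) :=
  volume.withDensity fun x => ENNReal.ofReal (areaElement (gradient c.ψ x))

/-- Near `p`, the surface measure is the image of the weighted measure on the base. -/
theorem surfaceMeasure_restrict {s : Set (EuclideanSpace ℝ (Fin d))} (hs : MeasurableSet s)
    (hsub : s ⊆ Metric.ball p c.ρ) :
    (surfaceMeasure Ω).restrict s = (c.baseMeasure.restrict (c.graph ⁻¹' s)).map c.graph := by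
  have hcomap : (Measure.euclideanHausdorffMeasure (d - 1)).comap c.graph = c.baseMeasure := by
    have := comap_graph_eq_withDensity c.lipschitz c.dist_graph_sq c.measurableEmbedding_graph
    rwa [finrank_euclideanSpace_fin] at this
  rw [← Measure.restrict_map c.continuous_graph.measurable hs, ← hcomap,
    c.measurableEmbedding_graph.map_comap, surfaceMeasure, Measure.restrict_restrict hs,
    Measure.restrict_restrict hs]
  congr 1
  ext z
  constructor
  · rintro ⟨h1, h2⟩; exact ⟨h1, c.mem_range_graph (hsub h1) h2⟩
  · rintro ⟨h1, x, rfl⟩; exact ⟨h1, c.graph_mem_frontier (hsub h1)⟩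

theorem measurable_density :
    Measurable fun x => ENNReal.ofReal (areaElement (gradient c.ψ x)) :=
  (continuous_areaElement.measurable.comp measurable_gradient).ennreal_ofReal

theorem volume_le_baseMeasure : volume ≤ c.baseMeasure := by
  refine Measure.le_iff.2 fun s hs => ?_
  rw [baseMeasure, withDensity_apply _ hs, ← setLIntegral_one]
  exact lintegral_mono fun x => ENNReal.one_le_ofReal.2 (one_le_areaElement _)

theorem ae_of_ae_surface {P : EuclideanSpace ℝ (Fin d) → Prop}
    (h : ∀ᵐ s ∂(surfaceMeasure Ω), P s) :
    ∀ᵐ x, c.graph x ∈ Metric.ball p c.ρ → P (c.graph x) := by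
  have h1 := ae_restrict_of_ae (s := Metric.ball p c.ρ) h
  rw [c.surfaceMeasure_restrict measurableSet_ball subset_rfl,
    c.measurableEmbedding_graph.ae_map_iff,
    ae_restrict_iff' (c.continuous_graph.measurable measurableSet_ball)] at h1
  exact (Measure.absolutelyContinuous_of_le c.volume_le_baseMeasure).ae_le h1

theorem dist_graph_le_of_dist_pt {x : EuclideanSpace ℝ (Fin (d - 1))} {s : ℝ}
    (z : EuclideanSpace ℝ (Fin (d - 1))) :
    |s| ≤ (1 + c.L) * dist (c.pt x s) (c.graph z) := by
  have h1 := c.dist_fst_le (x, c.ψ x + s) (z, c.ψ z + 0)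
  have h2 := c.abs_snd_sub_le (x, c.ψ x + s) (z, c.ψ z + 0)
  have h3 := c.lipschitz.dist_le_mul x z
  rw [Real.dist_eq] at h3
  have h4 : |s| ≤ |c.ψ x + s - (c.ψ z + 0)| + |c.ψ x - c.ψ z| := by
    have := abs_sub (c.ψ x + s - (c.ψ z + 0)) (c.ψ x - c.ψ z)
    rwa [show c.ψ x + s - (c.ψ z + 0) - (c.ψ x - c.ψ z) = s by ring] at this
  have h5 := mul_le_mul_of_nonneg_left h1 c.L.coe_nonneg
  simp only at h1 h2 h5
  rw [graph, pt, pt]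
  linarith

/-- An aperture wide enough to contain the vertical segments below the graph. -/
noncomputable def aperture : ℝ := 1 + c.L

theorem aperture_pos : 0 < c.aperture := by unfold aperture; positivity

theorem pt_mem_approachRegion {x : EuclideanSpace ℝ (Fin (d - 1))} {t : ℝ} (ht : 0 < t)
    (htρ : t < c.ρ / 4) (hx : c.graph x ∈ Metric.ball p (c.ρ / 2)) :
    c.pt x (-t) ∈ approachRegion Ω c.aperture (c.graph x) := by
  have hd : dist (c.pt x (-t)) (c.graph x) = t := by
    rw [dist_pt_graph, abs_neg, abs_of_pos ht]
  have hx' : dist (c.graph x) p < c.ρ / 2 := hx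
  have hb : c.pt x (-t) ∈ Metric.ball p c.ρ := by
    rw [Metric.mem_ball]
    linarith [dist_triangle (c.pt x (-t)) (c.graph x) p, c.ρ_pos]
  refine ⟨(c.pt_mem_iff hb).2 (by linarith), ?_⟩
  have hne : (frontier Ω).Nonempty := ⟨p, c.mem_frontier⟩
  have hL : 0 < 1 + (c.L : ℝ) := by positivity
  have hinf : t / (1 + c.L) ≤ Metric.infDist (c.pt x (-t)) (frontier Ω) := by
    refine (Metric.le_infDist hne).2 fun z hz => ?_
    rw [div_le_iff₀' hL]
    by_cases hzb : z ∈ Metric.ball p c.ρ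
    · obtain ⟨y, rfl⟩ := c.mem_range_graph hzb hz
      have := c.dist_graph_le_of_dist_pt (x := x) (s := -t) y
      rwa [abs_neg, abs_of_pos ht] at this
    · rw [Metric.mem_ball, not_lt] at hzb
      have h1 : t ≤ dist (c.pt x (-t)) z := by
        have := dist_triangle4 z (c.pt x (-t)) (c.graph x) p
        rw [dist_comm z (c.pt x (-t))] at this
        linarith
      nlinarith [c.L.coe_nonneg, dist_nonneg (x := c.pt x (-t)) (y := z)]
  rw [hd, aperture]
  have h2 : t < (1 + (1 + c.L)) * (t / (1 + c.L)) := by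
    rw [mul_div_assoc', lt_div_iff₀ hL]; nlinarith
  exact h2.trans_le (mul_le_mul_of_nonneg_left hinf (by positivity))

/-- A radius such that the ball around `p` is reached by short vertical segments. -/
noncomputable def radius : ℝ := c.ρ / (8 * (1 + c.L))

theorem radius_pos : 0 < c.radius := div_pos c.ρ_pos (by positivity)

theorem mul_radius : (1 + c.L) * c.radius = c.ρ / 8 := by
  have : (1 + (c.L : ℝ)) ≠ 0 := by positivity
  unfold radius; field_simp

theorem radius_le : c.radius ≤ c.ρ / 8 := by
  rw [← c.mul_radius]
  nlinarith [c.radius_pos, c.L.coe_nonneg]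

theorem ball_radius_subset : Metric.ball p c.radius ⊆ Metric.ball p c.ρ :=
  Metric.ball_subset_ball (by linarith [c.radius_le, c.ρ_pos])

theorem of_pt_mem_ball {x : EuclideanSpace ℝ (Fin (d - 1))} {s : ℝ}
    (h : c.pt x s ∈ Metric.ball p c.radius) :
    |s| < c.ρ / 8 ∧ c.graph x ∈ Metric.ball p (c.ρ / 2) := by
  obtain ⟨z, hz⟩ := c.mem_range_graph (Metric.mem_ball_self c.ρ_pos) c.mem_frontier
  rw [Metric.mem_ball] at h
  have h1 : |s| < c.ρ / 8 := by
    have := c.dist_graph_le_of_dist_pt (x := x) (s := s) z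
    rw [hz] at this
    rw [← c.mul_radius]
    exact this.trans_lt (by have := c.L.coe_nonneg; gcongr)
  refine ⟨h1, ?_⟩
  rw [Metric.mem_ball]
  have h2 := dist_triangle (c.graph x) (c.pt x s) p
  rw [dist_comm (c.graph x) (c.pt x s), dist_pt_graph] at h2
  linarith [c.radius_le, c.ρ_pos]

end GraphChart

end QuasiOrth

namespace QuasiOrth

open scoped ENNReal NNReal RealInnerProductSpace

variable {d : ℕ} {Ω : Set (EuclideanSpace ℝ (Fin d))} {p : EuclideanSpace ℝ (Fin d)}

theorem IsOutwardNormal.unique {s n n' : EuclideanSpace ℝ (Fin d)} (h : IsOutwardNormal Ω s n)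
    (h' : IsOutwardNormal Ω s n') : n = n' := by
  by_contra hne
  have hi : ⟪n, n'⟫ < 1 := (inner_lt_one_iff_real_of_norm_eq_one h.1 h'.1).2 hne
  set z := n - n'
  have hz : 0 < ‖z‖ := norm_pos_iff.2 (sub_ne_zero.2 hne)
  have h1 : ⟪n, z⟫ = 1 - ⟪n, n'⟫ := by
    rw [inner_sub_right, real_inner_self_eq_norm_sq, h.1]; norm_num
  have h2 : ⟪n', z⟫ = -(1 - ⟪n, n'⟫) := by
    rw [inner_sub_right, real_inner_self_eq_norm_sq, h'.1, real_inner_comm]; ring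
  set ε := (1 - ⟪n, n'⟫) / (2 * ‖z‖) with hε
  have hε0 : 0 < ε := div_pos (by linarith) (by positivity)
  have hεz : ε * ‖z‖ = (1 - ⟪n, n'⟫) / 2 := by rw [hε]; field_simp
  have hlim : Tendsto (fun t : ℝ => s + t • z) (𝓝[>] 0) (𝓝 s) := by
    have : Continuous fun t : ℝ => s + t • z := by fun_prop
    have := this.tendsto 0
    simp only [zero_smul, add_zero] at this
    exact this.mono_left nhdsWithin_le_nhds
  obtain ⟨t, ⟨ha, hb⟩, ht⟩ := ((hlim.eventually ((h.2 ε hε0).and (h'.2 ε hε0))).and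
    self_mem_nhdsWithin).exists
  have ht : 0 < t := ht
  simp only [add_sub_cancel_left, inner_smul_right, norm_smul, Real.norm_eq_abs,
    abs_of_pos ht] at ha hb
  have hmul : ε * (t * ‖z‖) = t * ((1 - ⟪n, n'⟫) / 2) := by rw [← hεz]; ring
  rw [hmul] at ha hb
  have hpos : 0 < t * (1 - ⟪n, n'⟫) := mul_pos ht (by linarith)
  by_cases hm : s + t • z ∈ Ω
  · have := ha.1 hm
    rw [h1] at this
    linarith
  · have := hb.2 hm
    rw [h2] at this
    linarith

theorem IsOutwardNormal.outwardNormal_eq {s n : EuclideanSpace ℝ (Fin d)}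
    (h : IsOutwardNormal Ω s n) : outwardNormal Ω s = n := by
  have hex : ∃ n, IsOutwardNormal Ω s n := ⟨n, h⟩
  rw [outwardNormal, dif_pos hex]
  exact hex.choose_spec.unique h

namespace GraphChart

variable (c : GraphChart Ω p)

/-- The normal vector `(-∇ψ, 1)` of the graph, not normalized. -/
noncomputable def conormal (x : EuclideanSpace ℝ (Fin (d - 1))) : EuclideanSpace ℝ (Fin d) :=
  c.coord (-gradient c.ψ x, 1)

theorem norm_conormal (x : EuclideanSpace ℝ (Fin (d - 1))) :
    ‖c.conormal x‖ = areaElement (gradient c.ψ x) := by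
  rw [conormal, areaElement, ← Real.sqrt_sq (norm_nonneg (c.coord _)), norm_coord_sq]
  simp [add_comm]

theorem measurable_conormal : Measurable c.conormal :=
  c.coord.continuous.measurable.comp (measurable_gradient.neg.prodMk measurable_const)

theorem norm_gradient_le (x : EuclideanSpace ℝ (Fin (d - 1))) : ‖gradient c.ψ x‖ ≤ c.L := by
  rw [gradient, LinearIsometryEquiv.norm_map]
  exact norm_fderiv_le_of_lipschitz ℝ c.lipschitz

theorem norm_conormal_le (x : EuclideanSpace ℝ (Fin (d - 1))) : ‖c.conormal x‖ ≤ 1 + c.L := by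
  rw [norm_conormal]
  have h := areaElement_le_add (gradient c.ψ x) 0
  have h0 : areaElement (0 : EuclideanSpace ℝ (Fin (d - 1))) = 1 := by simp [areaElement]
  rw [h0, sub_zero] at h
  linarith [c.norm_gradient_le x]

theorem isOutwardNormal_graph {x : EuclideanSpace ℝ (Fin (d - 1))}
    (hx : DifferentiableAt ℝ c.ψ x) (hb : c.graph x ∈ Metric.ball p c.ρ) :
    IsOutwardNormal Ω (c.graph x) ((areaElement (gradient c.ψ x))⁻¹ • c.conormal x) := by
  set J := areaElement (gradient c.ψ x)
  have hJ : 1 ≤ J := one_le_areaElement _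
  have hJ0 : 0 < J := by linarith
  have hJi : J⁻¹ ≤ 1 := inv_le_one_of_one_le₀ hJ
  constructor
  · rw [norm_smul, norm_conormal, norm_inv, Real.norm_of_nonneg hJ0.le, inv_mul_cancel₀ hJ0.ne']
  intro ε hε
  have hlim : Tendsto (fun z => (c.coord.symm z).1) (𝓝 (c.graph x)) (𝓝 x) := by
    have : Continuous fun z => (c.coord.symm z).1 := by fun_prop
    have := this.tendsto (c.graph x)
    simpa [graph, pt] using this
  have hdiff := hlim.eventually ((hx.hasGradientAt.hasFDerivAt.isLittleO).def hε)
  filter_upwards [hdiff, Metric.isOpen_ball.mem_nhds hb] with z hz hzb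
  obtain ⟨⟨y, η⟩, rfl⟩ := c.coord.surjective z
  rw [ContinuousLinearEquiv.symm_apply_apply] at hz
  have hmem : c.coord (y, η) ∈ Ω ↔ η < c.ψ y := by
    rw [c.mem_iff _ hzb, e_coord]; rfl
  have hdist : dist y x ≤ ‖c.coord (y, η) - c.graph x‖ := by
    rw [← dist_eq_norm]; exact c.dist_fst_le (y, η) (x, c.ψ x + 0)
  have hin : ⟪c.conormal x, c.coord (y, η) - c.graph x⟫ =
      (η - c.ψ x) - ⟪gradient c.ψ x, y - x⟫ := by
    rw [conormal, graph, pt, ← map_sub, inner_coord]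
    simp only [Prod.fst_sub, Prod.snd_sub, inner_neg_left]; ring
  have hz' : |c.ψ y - c.ψ x - ⟪gradient c.ψ x, y - x⟫| ≤ ε * ‖y - x‖ := by
    simpa [Real.norm_eq_abs] using hz
  rw [← dist_eq_norm y x] at hz'
  have hz2 := abs_le.1 (hz'.trans (mul_le_mul_of_nonneg_left hdist hε.le))
  set D := ε * ‖c.coord (y, η) - c.graph x‖
  have hD : 0 ≤ D := by positivity
  have hJD : J⁻¹ * D ≤ D := by nlinarith
  have hJi0 : 0 < J⁻¹ := inv_pos.2 hJ0
  rw [inner_smul_left, hin]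
  simp only [conj_trivial]
  constructor
  · intro hm
    have h1 := hmem.1 hm
    refine le_trans ?_ hJD
    exact mul_le_mul_of_nonneg_left (by linarith [hz2.2]) hJi0.le
  · intro hm
    have h1 := not_lt.1 fun h => hm (hmem.2 h)
    refine le_trans (neg_le_neg hJD) ?_
    rw [← mul_neg]
    exact mul_le_mul_of_nonneg_left (by linarith [hz2.1]) hJi0.le

theorem areaElement_smul_outwardNormal {x : EuclideanSpace ℝ (Fin (d - 1))}
    (hx : DifferentiableAt ℝ c.ψ x) (hb : c.graph x ∈ Metric.ball p c.ρ) :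
    areaElement (gradient c.ψ x) • outwardNormal Ω (c.graph x) = c.conormal x := by
  rw [(c.isOutwardNormal_graph hx hb).outwardNormal_eq, smul_smul, mul_inv_cancel₀, one_smul]
  exact (zero_lt_one.trans_le (one_le_areaElement _)).ne'

end GraphChart

/-- The nontangential maximal function of `f`. -/
noncomputable def maximalFn {F : Type*} [NormedAddCommGroup F]
    (Ω : Set (EuclideanSpace ℝ (Fin d))) (a : ℝ) (f : EuclideanSpace ℝ (Fin d) → F)
    (s : EuclideanSpace ℝ (Fin d)) : ℝ≥0∞ :=
  ⨆ x ∈ approachRegion Ω a s, ‖f x‖ₑ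

section MaximalFn

variable {F : Type*} [NormedAddCommGroup F] {a : ℝ} {f : EuclideanSpace ℝ (Fin d) → F}

theorem enorm_le_maximalFn {x s : EuclideanSpace ℝ (Fin d)} (hx : x ∈ approachRegion Ω a s) :
    ‖f x‖ₑ ≤ maximalFn Ω a f s :=
  le_iSup₂ (f := fun x (_ : x ∈ approachRegion Ω a s) => ‖f x‖ₑ) x hx

theorem measurable_maximalFn : Measurable (maximalFn Ω a f) := by
  refine LowerSemicontinuous.measurable fun s y hy => ?_
  obtain ⟨x, hx⟩ := lt_iSup_iff.1 hy
  obtain ⟨hxa, hxy⟩ := lt_iSup_iff.1 hx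
  have hopen : IsOpen {s | dist x s < (1 + a) * Metric.infDist x (frontier Ω)} :=
    isOpen_lt (by fun_prop) continuous_const
  filter_upwards [hopen.mem_nhds hxa.2] with s' hs'
  exact hxy.trans_le (enorm_le_maximalFn ⟨hxa.1, hs'⟩)

theorem GraphChart.pt_tendsto_approach (c : GraphChart Ω p) {x : EuclideanSpace ℝ (Fin (d - 1))}
    (hx : c.graph x ∈ Metric.ball p (c.ρ / 2)) :
    Tendsto (fun t => c.pt x (-t)) (𝓝[>] 0)
      (𝓝[approachRegion Ω c.aperture (c.graph x)] (c.graph x)) := by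
  refine tendsto_nhdsWithin_iff.2 ⟨?_, ?_⟩
  · have := (c.continuous_pt_right x).comp continuous_neg |>.tendsto 0
    simp only [Function.comp, neg_zero] at this
    exact this.mono_left nhdsWithin_le_nhds
  · filter_upwards [Ioo_mem_nhdsGT (div_pos c.ρ_pos (by norm_num : (0 : ℝ) < 4))] with t ht
    exact c.pt_mem_approachRegion ht.1 ht.2 hx

theorem GraphChart.tendsto_boundaryValue (c : GraphChart Ω p)
    {x : EuclideanSpace ℝ (Fin (d - 1))} (hx : c.graph x ∈ Metric.ball p (c.ρ / 2)) {y : F}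
    (h : HasBoundaryValue Ω f (c.graph x) y) :
    Tendsto (fun t => f (c.pt x (-t))) (𝓝[>] 0) (𝓝 y) :=
  (h _ c.aperture_pos).comp (c.pt_tendsto_approach hx)

theorem GraphChart.enorm_boundaryValue_le (c : GraphChart Ω p)
    {x : EuclideanSpace ℝ (Fin (d - 1))} (hx : c.graph x ∈ Metric.ball p (c.ρ / 2)) {y : F}
    (h : HasBoundaryValue Ω f (c.graph x) y) :
    ‖y‖ₑ ≤ maximalFn Ω c.aperture f (c.graph x) := by
  refine le_of_tendsto (c.tendsto_boundaryValue hx h).enorm ?_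
  filter_upwards [Ioo_mem_nhdsGT (div_pos c.ρ_pos (by norm_num : (0 : ℝ) < 4))] with t ht
  exact enorm_le_maximalFn (c.pt_mem_approachRegion ht.1 ht.2 hx)

theorem GraphChart.aestronglyMeasurable_comp_graph (c : GraphChart Ω p)
    (hf : ContinuousOn f Ω) {w : EuclideanSpace ℝ (Fin d) → F}
    (hw : ∀ᵐ s ∂(surfaceMeasure Ω), HasBoundaryValue Ω f s (w s)) :
    AEStronglyMeasurable (fun x => w (c.graph x))
      (volume.restrict (c.graph ⁻¹' Metric.ball p (c.ρ / 2))) := by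
  have hUo : IsOpen (c.graph ⁻¹' Metric.ball p (c.ρ / 2)) :=
    Metric.isOpen_ball.preimage c.continuous_graph
  have hρ4 : 0 < c.ρ / 4 := div_pos c.ρ_pos (by norm_num)
  set τ : ℕ → ℝ := fun n => (c.ρ / 4) / ((n : ℝ) + 2)
  have hτ0 : ∀ n, 0 < τ n := fun n => by positivity
  have hτ1 : ∀ n, τ n < c.ρ / 4 := fun n => div_lt_self hρ4 (by have := n.cast_nonneg (α := ℝ); linarith)
  have hτ : Tendsto τ atTop (𝓝[>] 0) := by
    refine tendsto_nhdsWithin_iff.2 ⟨?_, Eventually.of_forall hτ0⟩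
    exact Tendsto.div_atTop tendsto_const_nhds
      (tendsto_atTop_add_const_right _ _ tendsto_natCast_atTop_atTop)
  refine aestronglyMeasurable_of_tendsto_ae atTop
    (f := fun n x => f (c.pt x (-τ n))) (fun n => ?_) ?_
  · refine ContinuousOn.aestronglyMeasurable ?_ hUo.measurableSet
    exact hf.comp (c.continuous_pt_left _).continuousOn fun x hx =>
      (c.pt_mem_approachRegion (hτ0 n) (hτ1 n) hx).1
  · rw [ae_restrict_iff' hUo.measurableSet]
    filter_upwards [c.ae_of_ae_surface hw] with x hx hxU
    exact (c.tendsto_boundaryValue hxU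
      (hx (Metric.ball_subset_ball (by linarith [c.ρ_pos]) hxU))).comp hτ

end MaximalFn

end QuasiOrth

namespace QuasiOrth

open scoped ENNReal NNReal RealInnerProductSpace Manifold ContDiff

variable {d : ℕ} {Ω : Set (EuclideanSpace ℝ (Fin d))} {p : EuclideanSpace ℝ (Fin d)}

namespace GraphChart

variable (c : GraphChart Ω p)

theorem inner_conormal (x : EuclideanSpace ℝ (Fin (d - 1)))
    (q : EuclideanSpace ℝ (Fin (d - 1)) × ℝ) :
    ⟪c.conormal x, c.coord q⟫ = q.2 - fderiv ℝ c.ψ x q.1 := by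
  have h : ⟪gradient c.ψ x, q.1⟫ = fderiv ℝ c.ψ x q.1 :=
    InnerProductSpace.toDual_symm_apply
  rw [conormal, inner_coord]
  simp only [inner_neg_left, h]; ring

/-- The points deeper than `t` below the graph. -/
def below (t : ℝ) : Set (EuclideanSpace ℝ (Fin d)) := {z | (c.e z).snd < c.ψ (c.e z).fst - t}

theorem continuous_height : Continuous fun z => c.ψ (c.e z).fst - (c.e z).snd := by
  have h1 := c.coord.symm.continuous
  exact (c.lipschitz.continuous.comp h1.fst).sub h1.snd

theorem isOpen_below (t : ℝ) : IsOpen (c.below t) := by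
  have : c.below t = {z | t < c.ψ (c.e z).fst - (c.e z).snd} := by
    ext z; simp only [below, mem_ofPred_eq]; constructor <;> intro h <;> linarith
  rw [this]
  exact isOpen_lt continuous_const c.continuous_height

theorem mem_of_mem_below {t : ℝ} (ht : 0 ≤ t) {z : EuclideanSpace ℝ (Fin d)} (hz : z ∈ c.below t)
    (hb : z ∈ Metric.ball p c.ρ) : z ∈ Ω :=
  (c.mem_iff z hb).2 (lt_of_lt_of_le hz (by linarith))

/-- The divergence theorem for a constant direction below a vertical translate of the graph. -/
theorem integral_fderiv_below {t : ℝ} (ht : 0 < t) {h : EuclideanSpace ℝ (Fin d) → ℝ}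
    {K : Set (EuclideanSpace ℝ (Fin d))} (hK : IsCompact K) (hKb : K ⊆ Metric.ball p c.ρ)
    (h0 : ∀ x ∉ K, h x = 0) (hh : ContDiffOn ℝ 1 h Ω) (w : EuclideanSpace ℝ (Fin d)) :
    IntegrableOn (fun z => fderiv ℝ h z w) (c.below t) ∧
    Integrable (fun x => ⟪c.conormal x, w⟫ * h (c.pt x (-t))) ∧
    ∫ z in c.below t, fderiv ℝ h z w = ∫ x, ⟪c.conormal x, w⟫ * h (c.pt x (-t)) := by
  set Kt := K ∩ {z | t ≤ c.ψ (c.e z).fst - (c.e z).snd} with hKt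
  have hKtc : IsClosed Kt := hK.isClosed.inter (isClosed_le continuous_const c.continuous_height)
  have hKtΩ : Kt ⊆ Ω := fun z hz =>
    (c.mem_iff z (hKb hz.1)).2 (by have := hz.2; simp only [mem_ofPred_eq] at this; linarith)
  obtain ⟨η, hη0, hη1, -⟩ := exists_contMDiffMap_zero_one_nhds_of_isClosed
    (I := 𝓘(ℝ, EuclideanSpace ℝ (Fin d))) (n := ⊤) (s := Ωᶜ) (t := Kt)
    c.isOpen.isClosed_compl hKtc
    (disjoint_left.2 fun z hz hz' => hz (hKtΩ hz'))
  have hηs : ContDiff ℝ 1 η := η.contMDiff.contDiff.of_le (by exact_mod_cast le_top)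
  set g : EuclideanSpace ℝ (Fin d) → ℝ := fun z => η z * h z with hgdef
  have hg : ContDiff ℝ 1 g := by
    refine contDiff_iff_contDiffAt.2 fun z => ?_
    by_cases hz : z ∈ Ω
    · exact hηs.contDiffAt.mul (hh.contDiffAt (c.isOpen.mem_nhds hz))
    · have hev : g =ᶠ[𝓝 z] fun _ => 0 := by
        filter_upwards [hη0.filter_mono (nhds_le_nhdsSet hz)] with y hy
        simp [g, hy]
      exact contDiffAt_const.congr_of_eventuallyEq hev
  have hg0 : ∀ z ∉ K, g z = 0 := fun z hz => by simp [g, h0 z hz]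
  have hgc : HasCompactSupport g := HasCompactSupport.intro hK hg0
  have hgh : ∀ z, t ≤ c.ψ (c.e z).fst - (c.e z).snd → g =ᶠ[𝓝 z] h := by
    intro z hz
    by_cases hzK : z ∈ K
    · have hzt : z ∈ Kt := ⟨hzK, hz⟩
      filter_upwards [hη1.filter_mono (nhds_le_nhdsSet hzt)] with y hy
      simp [g, hy]
    · filter_upwards [hK.isClosed.isOpen_compl.mem_nhds hzK] with y hy
      rw [hg0 y hy, h0 y hy]
  have hbelow : ∀ z ∈ c.below t, t ≤ c.ψ (c.e z).fst - (c.e z).snd := fun z hz => by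
    simp only [below, mem_ofPred_eq] at hz; linarith
  have hpt : ∀ x, g (c.pt x (-t)) = h (c.pt x (-t)) := fun x => by
    refine (hgh _ ?_).eq_of_nhds
    rw [pt, e_coord]
    change t ≤ c.ψ x - (c.ψ x + -t)
    linarith
  have hmeas : MeasurableSet (c.below t) := (c.isOpen_below t).measurableSet
  have hfd : ∀ z ∈ c.below t, fderiv ℝ g z w = fderiv ℝ h z w := fun z hz => by
    rw [(hgh z (hbelow z hz)).fderiv_eq]
  refine ⟨?_, ?_, ?_⟩
  · refine IntegrableOn.congr_fun (f := fun z => fderiv ℝ g z w) ?_ hfd hmeas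
    refine (Continuous.integrable_of_hasCompactSupport
      ((hg.continuous_fderiv one_ne_zero).clm_apply continuous_const) ?_).integrableOn
    exact (hgc.fderiv ℝ).comp_left (g := fun l : EuclideanSpace ℝ (Fin d) →L[ℝ] ℝ => l w) rfl
  · simp_rw [← hpt]
    have hcs : HasCompactSupport fun x => g (c.pt x (-t)) := by
      refine HasCompactSupport.intro
        ((hK.image c.coord.symm.continuous).image continuous_fst) fun x hx => ?_
      by_contra hne
      refine hx ⟨c.coord.symm (c.pt x (-t)), ⟨_, by_contra fun h => hne (hg0 _ h), rfl⟩, ?_⟩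
      simp [pt]
    refine ((hg.continuous.comp (c.continuous_pt_left (-t))).integrable_of_hasCompactSupport
      hcs).bdd_mul (c := (1 + c.L) * ‖w‖)
      ((c.measurable_conormal.inner measurable_const).aestronglyMeasurable) (ae_of_all _ fun x => ?_)
    exact (norm_inner_le_norm _ _).trans (by gcongr; exact c.norm_conormal_le x)
  · rw [← setIntegral_congr_fun hmeas hfd,
      ← c.measurePreserving_coord.setIntegral_preimage_emb
        c.coord.toHomeomorph.measurableEmbedding]
    have hψt : LipschitzWith (c.L + 0) fun x => c.ψ x - t := c.lipschitz.sub (LipschitzWith.const t)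
    have hgcoord : ContDiff ℝ 1 (g ∘ c.coord) := hg.comp c.coord.contDiff
    have hgccoord : HasCompactSupport (g ∘ c.coord) := hgc.comp_homeomorph c.coord.toHomeomorph
    have key := integral_fderiv_subgraph hψt hgcoord hgccoord (c.coord.symm w).1 (c.coord.symm w).2
    have hpre : c.coord ⁻¹' c.below t =
        {q : EuclideanSpace ℝ (Fin (d - 1)) × ℝ | q.2 < c.ψ q.1 - t} := by
      ext q
      simp only [below, mem_preimage, mem_ofPred_eq, e_coord]
      rfl
    rw [hpre]
    refine Eq.trans ?_ (key.trans ?_)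
    · refine integral_congr_ae (ae_of_all _ fun q => ?_)
      simp only [Prod.mk.eta]
      rw [c.coord.comp_right_fderiv]
      simp
    · refine integral_congr_ae (ae_of_all _ fun x => ?_)
      simp only
      have h1 := c.inner_conormal x (c.coord.symm w)
      rw [ContinuousLinearEquiv.apply_symm_apply] at h1
      rw [h1, fderiv_sub_const, ← hpt x]
      rfl

theorem lintegral_graph_le (m : EuclideanSpace ℝ (Fin d) → ℝ≥0∞) :
    ∫⁻ x in c.graph ⁻¹' Metric.ball p (c.ρ / 2), m (c.graph x) ≤ ∫⁻ s, m s ∂(surfaceMeasure Ω) := by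
  have hb : Metric.ball p (c.ρ / 2) ⊆ Metric.ball p c.ρ :=
    Metric.ball_subset_ball (by linarith [c.ρ_pos])
  calc _ ≤ ∫⁻ x in c.graph ⁻¹' Metric.ball p (c.ρ / 2), m (c.graph x) ∂c.baseMeasure :=
        lintegral_mono' (Measure.restrict_mono subset_rfl c.volume_le_baseMeasure) le_rfl
    _ = ∫⁻ s in Metric.ball p (c.ρ / 2), m s ∂(surfaceMeasure Ω) := by
        rw [c.surfaceMeasure_restrict measurableSet_ball hb,
          c.measurableEmbedding_graph.lintegral_map]
    _ ≤ _ := setLIntegral_le_lintegral _ _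

theorem measurableSet_graph_preimage :
    MeasurableSet (c.graph ⁻¹' Metric.ball p (c.ρ / 2)) :=
  c.continuous_graph.measurable measurableSet_ball

theorem integrableOn_inter_ball {F : Type*} [NormedAddCommGroup F]
    {f : EuclideanSpace ℝ (Fin d) → F} (hf : ContinuousOn f Ω)
    (hN : ∫⁻ s, maximalFn Ω c.aperture f s ∂(surfaceMeasure Ω) < ⊤) :
    IntegrableOn f (Ω ∩ Metric.ball p c.radius) := by
  have hms : MeasurableSet (Ω ∩ Metric.ball p c.radius) :=
    c.isOpen.measurableSet.inter measurableSet_ball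
  refine ⟨(hf.mono inter_subset_left).aestronglyMeasurable hms, ?_⟩
  set T := (shearHomeomorph c.lipschitz.continuous).trans c.coord.toHomeomorph
  have hT : ∀ q, T q = c.pt q.1 q.2 := fun q => rfl
  have hTm : MeasurePreserving T :=
    c.measurePreserving_coord.comp (measurePreserving_shearHomeomorph c.lipschitz.continuous)
  set U := c.graph ⁻¹' Metric.ball p (c.ρ / 2)
  set m := fun x => maximalFn Ω c.aperture f (c.graph x)
  have hmm : Measurable m := measurable_maximalFn.comp c.continuous_graph.measurable
  have hsub : T ⁻¹' (Ω ∩ Metric.ball p c.radius) ⊆ U ×ˢ Ioo (-(c.ρ / 4)) 0 := by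
    rintro ⟨x, s⟩ ⟨h1, h2⟩
    rw [hT] at h1 h2
    obtain ⟨h3, h4⟩ := c.of_pt_mem_ball h2
    have h5 := (c.pt_mem_iff (c.ball_radius_subset h2)).1 h1
    refine ⟨h4, ?_, h5⟩
    simp only
    linarith [(abs_lt.1 h3).1, c.ρ_pos]
  have hle : ∀ q ∈ U ×ˢ Ioo (-(c.ρ / 4)) 0, ‖f (T q)‖ₑ ≤ m q.1 := by
    rintro ⟨x, s⟩ ⟨hx, hs⟩
    have := c.pt_mem_approachRegion (x := x) (t := -s) (by linarith [hs.2]) (by linarith [hs.1]) hx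
    rw [neg_neg] at this
    exact enorm_le_maximalFn this
  rw [hasFiniteIntegral_iff_enorm]
  calc ∫⁻ z in Ω ∩ Metric.ball p c.radius, ‖f z‖ₑ
      = ∫⁻ q in T ⁻¹' (Ω ∩ Metric.ball p c.radius), ‖f (T q)‖ₑ :=
        (hTm.setLIntegral_comp_preimage_emb T.measurableEmbedding (fun z => ‖f z‖ₑ) _).symm
    _ ≤ ∫⁻ q in U ×ˢ Ioo (-(c.ρ / 4)) 0, ‖f (T q)‖ₑ := lintegral_mono_set hsub
    _ ≤ ∫⁻ q in U ×ˢ Ioo (-(c.ρ / 4)) 0, m q.1 :=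
        setLIntegral_mono' (c.measurableSet_graph_preimage.prod measurableSet_Ioo) hle
    _ = (∫⁻ x in U, m x) * ENNReal.ofReal (c.ρ / 4) := by
        rw [Measure.volume_eq_prod, ← Measure.prod_restrict,
          lintegral_prod (fun q => m q.1) (hmm.comp measurable_fst).aemeasurable]
        simp [lintegral_mul_const _ hmm]
    _ < ⊤ := ENNReal.mul_lt_top ((c.lintegral_graph_le _).trans_lt hN) ENNReal.ofReal_lt_top

theorem integrableOn_conormal_inner {W w : EuclideanSpace ℝ (Fin d) → EuclideanSpace ℝ (Fin d)}
    (hW : ContinuousOn W Ω) (hw : ∀ᵐ s ∂(surfaceMeasure Ω), HasBoundaryValue Ω W s (w s))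
    (hN : ∫⁻ s, maximalFn Ω c.aperture W s ∂(surfaceMeasure Ω) < ⊤) :
    IntegrableOn (fun x => ⟪c.conormal x, w (c.graph x)⟫)
      (c.graph ⁻¹' Metric.ball p (c.ρ / 2)) := by
  have hwi : IntegrableOn (fun x => w (c.graph x)) (c.graph ⁻¹' Metric.ball p (c.ρ / 2)) := by
    refine ⟨c.aestronglyMeasurable_comp_graph hW hw, ?_⟩
    rw [hasFiniteIntegral_iff_enorm]
    refine lt_of_le_of_lt ?_ ((c.lintegral_graph_le (maximalFn Ω c.aperture W)).trans_lt hN)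
    refine lintegral_mono_ae ((ae_restrict_iff' c.measurableSet_graph_preimage).2 ?_)
    filter_upwards [c.ae_of_ae_surface hw] with x hx hxU
    exact c.enorm_boundaryValue_le hxU
      (hx (Metric.ball_subset_ball (by linarith [c.ρ_pos]) hxU))
  refine Integrable.mono' (hwi.norm.const_mul (1 + c.L))
    (c.measurable_conormal.aestronglyMeasurable.inner hwi.1) (ae_of_all _ fun x => ?_)
  exact (norm_inner_le_norm _ _).trans (by gcongr; exact c.norm_conormal_le x)

theorem flux_transfer (y : EuclideanSpace ℝ (Fin d) → EuclideanSpace ℝ (Fin d)) :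
    (IntegrableOn (fun s => ⟪outwardNormal Ω s, y s⟫) (Metric.ball p (c.ρ / 2))
      (surfaceMeasure Ω) ↔
    IntegrableOn (fun x => ⟪c.conormal x, y (c.graph x)⟫)
      (c.graph ⁻¹' Metric.ball p (c.ρ / 2))) ∧
    ∫ s in Metric.ball p (c.ρ / 2), ⟪outwardNormal Ω s, y s⟫ ∂(surfaceMeasure Ω) =
      ∫ x in c.graph ⁻¹' Metric.ball p (c.ρ / 2), ⟪c.conormal x, y (c.graph x)⟫ := by
  have hb : Metric.ball p (c.ρ / 2) ⊆ Metric.ball p c.ρ :=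
    Metric.ball_subset_ball (by linarith [c.ρ_pos])
  have hae : (fun x => (ENNReal.ofReal (areaElement (gradient c.ψ x))).toReal •
        ⟪outwardNormal Ω (c.graph x), y (c.graph x)⟫)
      =ᵐ[volume.restrict (c.graph ⁻¹' Metric.ball p (c.ρ / 2))]
      fun x => ⟪c.conormal x, y (c.graph x)⟫ := by
    rw [EventuallyEq, ae_restrict_iff' c.measurableSet_graph_preimage]
    filter_upwards [c.lipschitz.ae_differentiableAt] with x hx hxU
    rw [ENNReal.toReal_ofReal (by linarith [one_le_areaElement (gradient c.ψ x)]),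
      ← c.areaElement_smul_outwardNormal hx (hb hxU), inner_smul_left]
    simp
  have hlt : ∀ᵐ x ∂(volume.restrict (c.graph ⁻¹' Metric.ball p (c.ρ / 2))),
      ENNReal.ofReal (areaElement (gradient c.ψ x)) < ⊤ := ae_of_all _ fun x => ENNReal.ofReal_lt_top
  constructor
  · rw [IntegrableOn, c.surfaceMeasure_restrict measurableSet_ball hb,
      c.measurableEmbedding_graph.integrable_map_iff, baseMeasure,
      restrict_withDensity c.measurableSet_graph_preimage,
      integrable_withDensity_iff_integrable_smul' c.measurable_density hlt]
    exact integrable_congr hae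
  · rw [c.surfaceMeasure_restrict measurableSet_ball hb,
      c.measurableEmbedding_graph.integral_map, baseMeasure,
      restrict_withDensity c.measurableSet_graph_preimage,
      integral_withDensity_eq_integral_toReal_smul c.measurable_density hlt]
    exact integral_congr_ae hae

end GraphChart

end QuasiOrth

namespace QuasiOrth

open scoped ENNReal NNReal RealInnerProductSpace Manifold ContDiff

variable {d : ℕ} {Ω : Set (EuclideanSpace ℝ (Fin d))} {p : EuclideanSpace ℝ (Fin d)}

/-- The divergence of a vector field. -/
noncomputable def divergence (F : EuclideanSpace ℝ (Fin d) → EuclideanSpace ℝ (Fin d))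
    (x : EuclideanSpace ℝ (Fin d)) : ℝ :=
  ∑ i, ⟪EuclideanSpace.basisFun (Fin d) ℝ i,
    fderiv ℝ F x (EuclideanSpace.basisFun (Fin d) ℝ i)⟫

theorem divergence_of_eventuallyEq_zero
    {F : EuclideanSpace ℝ (Fin d) → EuclideanSpace ℝ (Fin d)} {x : EuclideanSpace ℝ (Fin d)}
    (h : F =ᶠ[𝓝 x] fun _ => 0) : divergence F x = 0 := by
  simp [divergence, h.fderiv_eq]

theorem fderiv_inner_const {F : EuclideanSpace ℝ (Fin d) → EuclideanSpace ℝ (Fin d)}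
    {x : EuclideanSpace ℝ (Fin d)} (h : DifferentiableAt ℝ F x) (b v : EuclideanSpace ℝ (Fin d)) :
    fderiv ℝ (fun z => ⟪b, F z⟫) x v = ⟪b, fderiv ℝ F x v⟫ := by
  have := (innerSL ℝ b).hasFDerivAt.comp x h.hasFDerivAt
  exact congrArg (fun l : EuclideanSpace ℝ (Fin d) →L[ℝ] ℝ => l v) this.fderiv

namespace GraphChart

variable (c : GraphChart Ω p)

theorem integral_divergence_below {t : ℝ} (ht : 0 < t)
    {F : EuclideanSpace ℝ (Fin d) → EuclideanSpace ℝ (Fin d)}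
    {K : Set (EuclideanSpace ℝ (Fin d))} (hK : IsCompact K) (hKb : K ⊆ Metric.ball p c.ρ)
    (h0 : ∀ x ∉ K, F x = 0) (hF : ContDiffOn ℝ 1 F Ω) :
    Integrable (fun x => ⟪c.conormal x, F (c.pt x (-t))⟫) ∧
    ∫ z in c.below t, divergence F z = ∫ x, ⟪c.conormal x, F (c.pt x (-t))⟫ := by
  set b := EuclideanSpace.basisFun (Fin d) ℝ
  have hdiff : ∀ z ∈ c.below t, DifferentiableAt ℝ F z := by
    intro z hz
    by_cases hzK : z ∈ K
    · have hzΩ := c.mem_of_mem_below ht.le hz (hKb hzK)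
      exact (hF.contDiffAt (c.isOpen.mem_nhds hzΩ)).differentiableAt one_ne_zero
    · have hev : F =ᶠ[𝓝 z] fun _ => 0 := by
        filter_upwards [hK.isClosed.isOpen_compl.mem_nhds hzK] with y hy using h0 y hy
      exact (differentiableAt_const 0).congr_of_eventuallyEq hev
  have key := fun i => c.integral_fderiv_below ht (h := fun z => ⟪b i, F z⟫) hK hKb
    (fun x hx => by rw [h0 x hx, inner_zero_right]) (contDiffOn_const.inner ℝ hF) (b i)
  have hsum : ∀ x, ⟪c.conormal x, F (c.pt x (-t))⟫ =
      ∑ i, ⟪c.conormal x, b i⟫ * ⟪b i, F (c.pt x (-t))⟫ := fun x =>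
    (b.sum_inner_mul_inner _ _).symm
  have hdiv : ∀ z ∈ c.below t, divergence F z = ∑ i, fderiv ℝ (fun z => ⟪b i, F z⟫) z (b i) :=
    fun z hz => Finset.sum_congr rfl fun i _ => (fderiv_inner_const (hdiff z hz) _ _).symm
  simp_rw [hsum]
  refine ⟨integrable_finsetSum _ fun i _ => (key i).2.1, ?_⟩
  rw [setIntegral_congr_fun (c.isOpen_below t).measurableSet hdiv,
    integral_finsetSum _ fun i _ => (key i).1, integral_finsetSum _ fun i _ => (key i).2.1]
  exact Finset.sum_congr rfl fun i _ => (key i).2.2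

/-- The divergence theorem for a vector field localized near `p`. -/
theorem integral_divergence_smul
    {W w : EuclideanSpace ℝ (Fin d) → EuclideanSpace ℝ (Fin d)} {χ : EuclideanSpace ℝ (Fin d) → ℝ}
    (hW : ContDiffOn ℝ 1 W Ω) (hw : ∀ᵐ s ∂(surfaceMeasure Ω), HasBoundaryValue Ω W s (w s))
    (hN : ∫⁻ s, maximalFn Ω c.aperture W s ∂(surfaceMeasure Ω) < ⊤)
    (hχ : ContDiff ℝ 1 χ) (hχs : tsupport χ ⊆ Metric.ball p c.radius)
    (hint : IntegrableOn (divergence fun x => χ x • W x) Ω) :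
    ∫ x in Ω, divergence (fun x => χ x • W x) x =
      ∫ s, χ s * ⟪outwardNormal Ω s, w s⟫ ∂(surfaceMeasure Ω) := by
  set F := fun x => χ x • W x with hFdef
  set U := c.graph ⁻¹' Metric.ball p (c.ρ / 2)
  have hρ := c.ρ_pos
  have hK : IsCompact (tsupport χ) :=
    Metric.isCompact_of_isClosed_isBounded (isClosed_tsupport χ)
      (Metric.isBounded_ball.subset hχs)
  have hχ0 : ∀ x ∉ tsupport χ, χ x = 0 := fun x hx => image_eq_zero_of_notMem_tsupport hx
  have hF0 : ∀ x ∉ tsupport χ, F x = 0 := fun x hx => by simp [F, hχ0 x hx]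
  have hFc : ContDiffOn ℝ 1 F Ω := hχ.contDiffOn.smul hW
  obtain ⟨M, hM⟩ : ∃ M, ∀ x, ‖χ x‖ ≤ M :=
    (hχ.continuous.bounded_above_of_compact_support hK)
  have hM0 : 0 ≤ M := (norm_nonneg _).trans (hM 0)
  have hslab := fun t (ht : 0 < t) => c.integral_divergence_below ht hK
    (hχs.trans c.ball_radius_subset) hF0 hFc
  -- the volume integrals converge
  have hvol : Tendsto (fun t => ∫ z in c.below t, divergence F z) (𝓝[>] 0)
      (𝓝 (∫ x in Ω, divergence F x)) := by
    have hdz : ∀ z ∉ tsupport χ, divergence F z = 0 := fun z hz =>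
      divergence_of_eventuallyEq_zero <| by
        filter_upwards [(isClosed_tsupport χ).isOpen_compl.mem_nhds hz] with y hy using hF0 y hy
    have heq : ∀ t > 0, ∫ z in c.below t, divergence F z =
        ∫ z in Ω, (c.below t).indicator (divergence F) z := by
      intro t ht
      rw [← integral_indicator (c.isOpen_below t).measurableSet,
        ← integral_indicator c.isOpen.measurableSet]
      congr 1
      ext z
      by_cases hz : z ∈ tsupport χ
      · by_cases hzb : z ∈ c.below t
        · rw [indicator_of_mem (c.mem_of_mem_below ht.le hzb (c.ball_radius_subset (hχs hz)))]
        · simp [indicator, hzb]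
      · simp [indicator, hdz z hz]
    refine Tendsto.congr' (f₁ := fun t => ∫ z in Ω, (c.below t).indicator (divergence F) z) ?_ ?_
    · filter_upwards [self_mem_nhdsWithin] with t ht using (heq t ht).symm
    · refine tendsto_integral_filter_of_dominated_convergence (fun z => ‖divergence F z‖)
        (Eventually.of_forall fun t => hint.1.indicator (c.isOpen_below t).measurableSet)
        (Eventually.of_forall fun t => ae_of_all _ fun z => norm_indicator_le_norm_self _ _)
        hint.norm ?_
      refine (ae_restrict_iff' c.isOpen.measurableSet).2 (ae_of_all _ fun z hz => ?_)
      by_cases hzs : z ∈ tsupport χ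
      · have h1 := (c.mem_iff z (c.ball_radius_subset (hχs hzs))).1 hz
        refine tendsto_const_nhds.congr' ?_
        filter_upwards [Ioo_mem_nhdsGT (sub_pos.2 h1)] with t ht
        rw [indicator_of_mem]
        have := ht.2
        simp only [below, mem_ofPred_eq]
        linarith
      · simp only [indicator, hdz z hzs, ite_self]
        exact tendsto_const_nhds
  -- the surface integrals converge
  have hpt0 : ∀ x t, x ∉ U → F (c.pt x t) = 0 := fun x t hx => hF0 _ fun h =>
    hx (c.of_pt_mem_ball (hχs h)).2
  have hNfin : ∫⁻ x in U, maximalFn Ω c.aperture W (c.graph x) ≠ ⊤ :=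
    ((c.lintegral_graph_le (maximalFn Ω c.aperture W)).trans_lt hN).ne
  have hmm : Measurable fun x => maximalFn Ω c.aperture W (c.graph x) :=
    measurable_maximalFn.comp c.continuous_graph.measurable
  have hsurf : Tendsto (fun t => ∫ x, ⟪c.conormal x, F (c.pt x (-t))⟫) (𝓝[>] 0)
      (𝓝 (∫ x in U, ⟪c.conormal x, χ (c.graph x) • w (c.graph x)⟫)) := by
    have heq : ∀ t, ∫ x, ⟪c.conormal x, F (c.pt x (-t))⟫ =
        ∫ x in U, ⟪c.conormal x, F (c.pt x (-t))⟫ := fun t =>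
      (setIntegral_eq_integral_of_forall_compl_eq_zero fun x hx => by
        rw [hpt0 x _ hx, inner_zero_right]).symm
    simp_rw [heq]
    refine tendsto_integral_filter_of_dominated_convergence
      (fun x => (1 + c.L) * (M * (maximalFn Ω c.aperture W (c.graph x)).toReal)) ?_ ?_ ?_ ?_
    · filter_upwards [self_mem_nhdsWithin] with t ht
      exact (hslab t ht).1.1.restrict
    · filter_upwards [Ioo_mem_nhdsGT (div_pos hρ (by norm_num : (0 : ℝ) < 4))] with t ht
      filter_upwards [ae_lt_top' hmm.aemeasurable hNfin,
        ae_restrict_mem c.measurableSet_graph_preimage] with x hx hxU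
      refine (norm_inner_le_norm _ _).trans ?_
      gcongr
      · exact c.norm_conormal_le x
      · rw [hFdef, norm_smul]
        gcongr
        · exact hM _
        · have := enorm_le_maximalFn (f := W) (c.pt_mem_approachRegion ht.1 ht.2 hxU)
          have h2 := ENNReal.toReal_mono hx.ne this
          rwa [toReal_enorm] at h2
    · exact ((integrable_toReal_of_lintegral_ne_top hmm.aemeasurable hNfin).const_mul M).const_mul _
    · rw [ae_restrict_iff' c.measurableSet_graph_preimage]
      filter_upwards [c.ae_of_ae_surface hw] with x hx hxU
      have h1 := c.tendsto_boundaryValue hxU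
        (hx (Metric.ball_subset_ball (by linarith) hxU))
      have h2 : Tendsto (fun t => χ (c.pt x (-t))) (𝓝[>] 0) (𝓝 (χ (c.graph x))) :=
        hχ.continuous.continuousAt.tendsto.comp
          ((c.pt_tendsto_approach hxU).mono_right nhdsWithin_le_nhds)
      exact tendsto_const_nhds.inner (h2.smul h1)
  have hlim := tendsto_nhds_unique (hvol.congr' ?_) hsurf
  · rw [hlim, ← (c.flux_transfer fun s => χ s • w s).2]
    rw [setIntegral_eq_integral_of_forall_compl_eq_zero]
    · simp_rw [inner_smul_right]
    · intro s hs
      rw [hχ0 s fun h => hs ?_]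
      · simp
      · exact Metric.ball_subset_ball (by linarith [c.radius_le]) (hχs h)
  · filter_upwards [self_mem_nhdsWithin] with t ht using (hslab t ht).2

end GraphChart

end QuasiOrth

namespace QuasiOrth

open scoped ENNReal NNReal RealInnerProductSpace Manifold ContDiff

variable {d : ℕ} {Ω : Set (EuclideanSpace ℝ (Fin d))} {p : EuclideanSpace ℝ (Fin d)}

theorem divergence_smul {χ : EuclideanSpace ℝ (Fin d) → ℝ}
    {W : EuclideanSpace ℝ (Fin d) → EuclideanSpace ℝ (Fin d)} {x : EuclideanSpace ℝ (Fin d)}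
    (hχ : DifferentiableAt ℝ χ x) (hW : DifferentiableAt ℝ W x) :
    divergence (fun z => χ z • W z) x = χ x * divergence W x + fderiv ℝ χ x (W x) := by
  have h1 : fderiv ℝ (fun z => χ z • W z) x =
      χ x • fderiv ℝ W x + (fderiv ℝ χ x).smulRight (W x) :=
    (hχ.hasFDerivAt.smul hW.hasFDerivAt).fderiv
  have h2 : fderiv ℝ χ x (W x) = ∑ i, ⟪EuclideanSpace.basisFun (Fin d) ℝ i, W x⟫ *
      fderiv ℝ χ x (EuclideanSpace.basisFun (Fin d) ℝ i) := by
    conv_lhs => rw [← (EuclideanSpace.basisFun (Fin d) ℝ).sum_repr' (W x), map_sum]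
    simp only [map_smul, smul_eq_mul]
  rw [h2, divergence, divergence, Finset.mul_sum, ← Finset.sum_add_distrib, h1]
  refine Finset.sum_congr rfl fun i _ => ?_
  simp only [add_apply, smul_apply,
    ContinuousLinearMap.smulRight_apply, inner_add_right, inner_smul_right]
  ring

theorem integral_divergence_eq_zero
    {F : EuclideanSpace ℝ (Fin d) → EuclideanSpace ℝ (Fin d)} (hF : ContDiff ℝ 1 F)
    (hFc : HasCompactSupport F) : ∫ x, divergence F x = 0 := by
  set b := EuclideanSpace.basisFun (Fin d) ℝ
  have hdiv : ∀ x, divergence F x = ∑ i, fderiv ℝ (fun z => ⟪b i, F z⟫) x (b i) := fun x =>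
    Finset.sum_congr rfl fun i _ =>
      (fderiv_inner_const (hF.differentiable one_ne_zero x) _ _).symm
  have hh : ∀ i, ContDiff ℝ 1 fun z => ⟪b i, F z⟫ := fun i => contDiff_const.inner ℝ hF
  have hc : ∀ i, HasCompactSupport fun z => ⟪b i, F z⟫ := fun i =>
    hFc.comp_left (g := fun y => ⟪b i, y⟫) (inner_zero_right _)
  have hint : ∀ i, Integrable fun x => fderiv ℝ (fun z => ⟪b i, F z⟫) x (b i) := fun i =>
    (((hh i).continuous_fderiv one_ne_zero).clm_apply continuous_const).integrable_of_hasCompactSupport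
      (((hc i).fderiv ℝ).comp_left (g := fun l : EuclideanSpace ℝ (Fin d) →L[ℝ] ℝ => l (b i)) rfl)
  simp_rw [hdiv]
  rw [integral_finsetSum _ fun i _ => hint i]
  refine Finset.sum_eq_zero fun i _ => ?_
  obtain ⟨C, hC⟩ := (hh i).lipschitzWith_of_hasCompactSupport (hc i) one_ne_zero
  rw [← integral_lineDeriv_eq_zero hC (hc i) (b i)]
  refine integral_congr_ae (ae_of_all _ fun x => ?_)
  exact (((hh i).differentiable one_ne_zero x).hasFDerivAt.hasLineDerivAt (b i)).lineDeriv.symm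

theorem ae_mem_frontier : ∀ᵐ s ∂(surfaceMeasure Ω), s ∈ frontier Ω :=
  ae_restrict_mem isClosed_frontier.measurableSet

theorem integral_divergence_smul_interior (hΩo : IsOpen Ω) (hΩb : Bornology.IsBounded Ω)
    {W w : EuclideanSpace ℝ (Fin d) → EuclideanSpace ℝ (Fin d)} {χ : EuclideanSpace ℝ (Fin d) → ℝ}
    (hW : ContDiffOn ℝ 1 W Ω) (hχ : ContDiff ℝ 1 χ) (hχs : tsupport χ ⊆ Ω) :
    ∫ x in Ω, divergence (fun x => χ x • W x) x =
      ∫ s, χ s * ⟪outwardNormal Ω s, w s⟫ ∂(surfaceMeasure Ω) := by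
  have hK : IsCompact (tsupport χ) :=
    Metric.isCompact_of_isClosed_isBounded (isClosed_tsupport χ) (hΩb.subset hχs)
  have hF0 : ∀ x ∉ tsupport χ, (fun x => χ x • W x) =ᶠ[𝓝 x] fun _ => 0 := fun x hx => by
    filter_upwards [(isClosed_tsupport χ).isOpen_compl.mem_nhds hx] with y hy
    simp [image_eq_zero_of_notMem_tsupport hy]
  have hF : ContDiff ℝ 1 fun x => χ x • W x := by
    refine contDiff_iff_contDiffAt.2 fun x => ?_
    by_cases hx : x ∈ tsupport χ
    · exact hχ.contDiffAt.smul (hW.contDiffAt (hΩo.mem_nhds (hχs hx)))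
    · exact contDiffAt_const.congr_of_eventuallyEq (hF0 x hx)
  have hFc : HasCompactSupport fun x => χ x • W x :=
    HasCompactSupport.intro hK fun x hx => (hF0 x hx).eq_of_nhds
  rw [setIntegral_eq_integral_of_forall_compl_eq_zero fun x hx =>
    divergence_of_eventuallyEq_zero (hF0 x fun h => hx (hχs h)), integral_divergence_eq_zero hF hFc]
  refine (integral_eq_zero_of_ae ?_).symm
  filter_upwards [ae_mem_frontier] with s hs
  have : s ∉ tsupport χ := fun h => by
    rw [hΩo.frontier_eq] at hs
    exact hs.2 (hχs h)
  simp [image_eq_zero_of_notMem_tsupport this]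

theorem closure_eq_union_frontier (hΩo : IsOpen Ω) {x : EuclideanSpace ℝ (Fin d)}
    (hx : x ∈ closure Ω) : x ∈ Ω ∨ x ∈ frontier Ω := by
  by_cases h : x ∈ Ω
  · exact Or.inl h
  · right; rw [hΩo.frontier_eq]; exact ⟨hx, h⟩

/-- A continuous function whose nontangential maximal functions are integrable is integrable. -/
theorem IsLipschitzDomain.integrableOn (hΩ : IsLipschitzDomain Ω) {F : Type*}
    [NormedAddCommGroup F] {f : EuclideanSpace ℝ (Fin d) → F} (hf : ContinuousOn f Ω)
    (hN : ∀ a > 0, ∫⁻ s, maximalFn Ω a f s ∂(surfaceMeasure Ω) < ⊤) : IntegrableOn f Ω := by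
  have hcpt : IsCompact (closure Ω) := hΩ.isBounded.isCompact_closure
  have h : IntegrableOn f (closure Ω) (volume.restrict Ω) := by
    refine LocallyIntegrableOn.integrableOn_isCompact (fun x hx => ?_) hcpt
    rcases closure_eq_union_frontier hΩ.isOpen hx with hx | hx
    · obtain ⟨r, hr, hrb⟩ := Metric.nhds_basis_closedBall.mem_iff.1 (hΩ.isOpen.mem_nhds hx)
      refine ⟨Metric.closedBall x r, nhdsWithin_le_nhds (Metric.closedBall_mem_nhds x hr), ?_⟩
      exact IntegrableOn.mono_measure
        ((hf.mono hrb).integrableOn_compact (isCompact_closedBall x r)) Measure.restrict_le_self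
    · obtain ⟨c⟩ := hΩ.exists_graphChart hx
      refine ⟨Metric.ball x c.radius,
        nhdsWithin_le_nhds (Metric.ball_mem_nhds x c.radius_pos), ?_⟩
      have := c.integrableOn_inter_ball hf (hN _ c.aperture_pos)
      rw [IntegrableOn, Measure.restrict_restrict measurableSet_ball, inter_comm]
      exact this
  have := h.mono_set (subset_closure (s := Ω))
  rwa [IntegrableOn, Measure.restrict_restrict hΩ.isOpen.measurableSet, inter_self] at this

theorem IsLipschitzDomain.integrable_flux (hΩ : IsLipschitzDomain Ω)
    {W w : EuclideanSpace ℝ (Fin d) → EuclideanSpace ℝ (Fin d)}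
    (hW : ContinuousOn W Ω) (hw : ∀ᵐ s ∂(surfaceMeasure Ω), HasBoundaryValue Ω W s (w s))
    (hN : ∀ a > 0, ∫⁻ s, maximalFn Ω a W s ∂(surfaceMeasure Ω) < ⊤) :
    Integrable (fun s => ⟪outwardNormal Ω s, w s⟫) (surfaceMeasure Ω) := by
  have hcpt : IsCompact (frontier Ω) :=
    hΩ.isBounded.isCompact_closure.of_isClosed_subset isClosed_frontier frontier_subset_closure
  have h : IntegrableOn (fun s => ⟪outwardNormal Ω s, w s⟫) (frontier Ω) (surfaceMeasure Ω) := by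
    refine LocallyIntegrableOn.integrableOn_isCompact (fun x hx => ?_) hcpt
    obtain ⟨c⟩ := hΩ.exists_graphChart hx
    refine ⟨Metric.ball x (c.ρ / 2),
      nhdsWithin_le_nhds (Metric.ball_mem_nhds x (half_pos c.ρ_pos)), ?_⟩
    exact (c.flux_transfer w).1.2 (c.integrableOn_conormal_inner hW hw (hN _ c.aperture_pos))
  rwa [IntegrableOn, Measure.restrict_eq_self_of_ae_mem ae_mem_frontier] at h

/-- The divergence theorem on a Lipschitz domain, for vector fields with nontangential boundary
values and integrable nontangential maximal functions. -/
theorem IsLipschitzDomain.integral_divergence (hΩ : IsLipschitzDomain Ω)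
    {W w : EuclideanSpace ℝ (Fin d) → EuclideanSpace ℝ (Fin d)}
    (hW : ContDiffOn ℝ 1 W Ω) (hw : ∀ᵐ s ∂(surfaceMeasure Ω), HasBoundaryValue Ω W s (w s))
    (hN : ∀ a > 0, ∫⁻ s, maximalFn Ω a W s ∂(surfaceMeasure Ω) < ⊤)
    (hdiv : IntegrableOn (divergence W) Ω) :
    ∫ x in Ω, divergence W x = ∫ s, ⟪outwardNormal Ω s, w s⟫ ∂(surfaceMeasure Ω) := by
  have hWint : IntegrableOn W Ω := hΩ.integrableOn hW.continuousOn hN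
  have hflux := hΩ.integrable_flux hW.continuousOn hw hN
  have hWd : ∀ x ∈ Ω, DifferentiableAt ℝ W x := fun x hx =>
    (hW.contDiffAt (hΩ.isOpen.mem_nhds hx)).differentiableAt one_ne_zero
  have hloc : ∀ x ∈ closure Ω, ∃ U, IsOpen U ∧ x ∈ U ∧ Bornology.IsBounded U ∧
      ∀ χ : EuclideanSpace ℝ (Fin d) → ℝ, ContDiff ℝ 1 χ → tsupport χ ⊆ U →
        IntegrableOn (divergence fun x => χ x • W x) Ω →
        ∫ x in Ω, divergence (fun x => χ x • W x) x =
          ∫ s, χ s * ⟪outwardNormal Ω s, w s⟫ ∂(surfaceMeasure Ω) := by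
    intro x hx
    rcases closure_eq_union_frontier hΩ.isOpen hx with hx | hx
    · exact ⟨Ω, hΩ.isOpen, hx, hΩ.isBounded, fun χ hχ hs _ =>
        integral_divergence_smul_interior hΩ.isOpen hΩ.isBounded hW hχ hs⟩
    · obtain ⟨c⟩ := hΩ.exists_graphChart hx
      exact ⟨Metric.ball x c.radius, Metric.isOpen_ball, Metric.mem_ball_self c.radius_pos,
        Metric.isBounded_ball, fun χ hχ hs hi =>
          c.integral_divergence_smul hW hw (hN _ c.aperture_pos) hχ hs hi⟩
  choose! U hUo hxU hUb hU using hloc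
  obtain ⟨T, hTs, hT⟩ := hΩ.isBounded.isCompact_closure.elim_nhds_subcover U
    fun x hx => (hUo x hx).mem_nhds (hxU x hx)
  obtain ⟨f, hf⟩ := SmoothPartitionOfUnity.exists_isSubordinate
    𝓘(ℝ, EuclideanSpace ℝ (Fin d)) (isClosed_closure (s := Ω)) (fun i : T => U i)
    (fun i => hUo i (hTs i i.2))
    (hT.trans (iUnion₂_subset fun x hx => subset_iUnion (fun i : T => U i) ⟨x, hx⟩))
  have hfs : ∀ i, ContDiff ℝ 1 (f i) := fun i =>
    (f i).contMDiff.contDiff.of_le (by exact_mod_cast le_top)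
  have hsum : ∀ x ∈ closure Ω, ∑ i, f i x = 1 := fun x hx => by
    rw [← finsum_eq_sum_of_fintype, f.sum_eq_one hx]
  have hfc : ∀ i, HasCompactSupport (f i) := fun i =>
    Metric.isCompact_of_isClosed_isBounded (isClosed_tsupport _)
      ((hUb i (hTs i i.2)).subset (hf i))
  have hdsum : ∀ x ∈ Ω, ∑ i, fderiv ℝ (f i) x = 0 := by
    intro x hx
    have hev : (fun z => ∑ i, f i z) =ᶠ[𝓝 x] fun _ => 1 := by
      filter_upwards [hΩ.isOpen.mem_nhds hx] with z hz using hsum z (subset_closure hz)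
    rw [← fderiv_fun_sum fun i _ => (hfs i).differentiable one_ne_zero x, hev.fderiv_eq]
    simp
  have hsm : ∀ i, ∀ x ∈ Ω, divergence (fun z => f i z • W z) x =
      f i x * divergence W x + fderiv ℝ (f i) x (W x) := fun i x hx =>
    divergence_smul ((hfs i).differentiable one_ne_zero x) (hWd x hx)
  have hi1 : ∀ i, IntegrableOn (fun x => f i x * divergence W x + fderiv ℝ (f i) x (W x)) Ω := by
    intro i
    obtain ⟨C, hC⟩ := (hfs i).continuous.bounded_above_of_compact_support (hfc i)
    obtain ⟨C', hC'⟩ := ((hfs i).continuous_fderiv one_ne_zero).bounded_above_of_compact_support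
      ((hfc i).fderiv ℝ)
    refine Integrable.add (hdiv.bdd_mul (hfs i).continuous.aestronglyMeasurable
      (ae_of_all _ hC)) ?_
    refine Integrable.mono' (hWint.norm.const_mul C') ?_ (ae_of_all _ fun x => ?_)
    · exact isBoundedBilinearMap_apply.continuous.comp_aestronglyMeasurable
        (((hfs i).continuous_fderiv one_ne_zero).aestronglyMeasurable.prodMk hWint.1)
    · exact (ContinuousLinearMap.le_opNorm _ _).trans (by gcongr; exact hC' x)
  have hi2 : ∀ i, IntegrableOn (divergence fun z => f i z • W z) Ω := fun i =>
    (hi1 i).congr_fun (fun x hx => (hsm i x hx).symm) hΩ.isOpen.measurableSet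
  have hfi : ∀ i, Integrable (fun s => f i s * ⟪outwardNormal Ω s, w s⟫) (surfaceMeasure Ω) := by
    intro i
    obtain ⟨C, hC⟩ := (hfs i).continuous.bounded_above_of_compact_support (hfc i)
    exact hflux.bdd_mul (hfs i).continuous.aestronglyMeasurable (ae_of_all _ hC)
  calc ∫ x in Ω, divergence W x
      = ∫ x in Ω, ∑ i, divergence (fun z => f i z • W z) x := by
        refine setIntegral_congr_fun hΩ.isOpen.measurableSet fun x hx => ?_
        rw [Finset.sum_congr rfl fun i _ => hsm i x hx, Finset.sum_add_distrib, ← Finset.sum_mul,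
          hsum x (subset_closure hx), one_mul, ← sum_apply, hdsum x hx]
        simp
    _ = ∑ i, ∫ x in Ω, divergence (fun z => f i z • W z) x :=
        integral_finsetSum _ fun i _ => hi2 i
    _ = ∑ i, ∫ s, f i s * ⟪outwardNormal Ω s, w s⟫ ∂(surfaceMeasure Ω) :=
        Finset.sum_congr rfl fun i _ => hU i (hTs i i.2) _ (hfs i) (hf i) (hi2 i)
    _ = ∫ s, ∑ i, f i s * ⟪outwardNormal Ω s, w s⟫ ∂(surfaceMeasure Ω) :=
        (integral_finsetSum _ fun i _ => hfi i).symm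
    _ = _ := by
        refine integral_congr_ae ?_
        filter_upwards [ae_mem_frontier] with s hs
        rw [← Finset.sum_mul, hsum s (frontier_subset_closure hs), one_mul]

end QuasiOrth

namespace QuasiOrth

open scoped ENNReal NNReal RealInnerProductSpace

variable {d : ℕ} {Ω : Set (EuclideanSpace ℝ (Fin d))}

section Calculus

variable {u v : EuclideanSpace ℝ (Fin d) → ℝ} {x : EuclideanSpace ℝ (Fin d)}

theorem divergence_add {F G : EuclideanSpace ℝ (Fin d) → EuclideanSpace ℝ (Fin d)}
    (hF : DifferentiableAt ℝ F x) (hG : DifferentiableAt ℝ G x) :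
    divergence (fun z => F z + G z) x = divergence F x + divergence G x := by
  simp only [divergence, fderiv_fun_add hF hG, add_apply, inner_add_right, Finset.sum_add_distrib]

theorem divergence_sub {F G : EuclideanSpace ℝ (Fin d) → EuclideanSpace ℝ (Fin d)}
    (hF : DifferentiableAt ℝ F x) (hG : DifferentiableAt ℝ G x) :
    divergence (fun z => F z - G z) x = divergence F x - divergence G x := by
  simp only [divergence, fderiv_fun_sub hF hG, sub_apply, inner_sub_right, Finset.sum_sub_distrib]

theorem divergence_id : divergence (fun z => z) x = d := by
  simp [divergence]

theorem fderiv_eq_inner_gradient (y : EuclideanSpace ℝ (Fin d)) :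
    fderiv ℝ u x y = ⟪gradient u x, y⟫ :=
  InnerProductSpace.toDual_symm_apply.symm

theorem contDiffAt_gradient (hu : ContDiffAt ℝ 2 u x) : ContDiffAt ℝ 1 (gradient u) x :=
  (InnerProductSpace.toDual ℝ (EuclideanSpace ℝ (Fin d))).symm.contDiff.contDiffAt.comp x
    (hu.fderiv_right (m := 1) (by norm_num))

theorem differentiableAt_gradient (hu : ContDiffAt ℝ 2 u x) : DifferentiableAt ℝ (gradient u) x :=
  (contDiffAt_gradient hu).differentiableAt one_ne_zero

theorem inner_fderiv_gradient (hu : ContDiffAt ℝ 2 u x) (y z : EuclideanSpace ℝ (Fin d)) :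
    ⟪fderiv ℝ (gradient u) x y, z⟫ = fderiv ℝ (fderiv ℝ u) x y z := by
  have h1 : DifferentiableAt ℝ (fderiv ℝ u) x :=
    (hu.fderiv_right (m := 1) (by norm_num)).differentiableAt one_ne_zero
  have h2 : fderiv ℝ (gradient u) x y =
      (InnerProductSpace.toDual ℝ (EuclideanSpace ℝ (Fin d))).symm (fderiv ℝ (fderiv ℝ u) x y) := by
    have := ((InnerProductSpace.toDual ℝ
      (EuclideanSpace ℝ (Fin d))).symm.toContinuousLinearEquiv.toContinuousLinearMap.hasFDerivAt).comp
        x h1.hasFDerivAt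
    exact congrArg (fun l : EuclideanSpace ℝ (Fin d) →L[ℝ] EuclideanSpace ℝ (Fin d) => l y)
      this.fderiv
  rw [h2, InnerProductSpace.toDual_symm_apply]

theorem inner_fderiv_gradient_comm (hu : ContDiffAt ℝ 2 u x) (y z : EuclideanSpace ℝ (Fin d)) :
    ⟪fderiv ℝ (gradient u) x y, z⟫ = ⟪y, fderiv ℝ (gradient u) x z⟫ := by
  rw [real_inner_comm _ y, inner_fderiv_gradient hu, inner_fderiv_gradient hu]
  exact (hu.isSymmSndFDerivAt (by simp)) y z

theorem divergence_gradient (hu : ContDiffAt ℝ 2 u x) :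
    divergence (gradient u) x = Laplacian.laplacian u x := by
  rw [InnerProductSpace.laplacian_eq_iteratedFDeriv_orthonormalBasis u
    (EuclideanSpace.basisFun (Fin d) ℝ), divergence]
  refine Finset.sum_congr rfl fun i _ => ?_
  rw [real_inner_comm, inner_fderiv_gradient hu, iteratedFDeriv_two_apply]
  rfl

theorem divergence_smul_gradient {f : EuclideanSpace ℝ (Fin d) → ℝ} (hf : DifferentiableAt ℝ f x)
    (hu : ContDiffAt ℝ 2 u x) :
    divergence (fun z => f z • gradient u z) x =
      f x * Laplacian.laplacian u x + fderiv ℝ f x (gradient u x) := by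
  rw [divergence_smul hf (differentiableAt_gradient hu), divergence_gradient hu]

end Calculus

/-- The vector field whose flux is the boundary form, as a function of the position, and of the
values `a`, `b` and gradients `α`, `β` of the two functions. -/
noncomputable def rellichField (A B : ℝ) (z : EuclideanSpace ℝ (Fin d)) (a : ℝ)
    (α : EuclideanSpace ℝ (Fin d)) (b : ℝ) (β : EuclideanSpace ℝ (Fin d)) :
    EuclideanSpace ℝ (Fin d) :=
  (((d : ℝ) - 2) / 2) • (b • α + a • β) + ((A + B) / 2 * (a * b) - ⟪α, β⟫) • z
    + (⟪z, α⟫ • β + ⟪z, β⟫ • α) - ((A - B) / 4 * ‖z‖ ^ 2) • (b • α - a • β)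

theorem divergence_rellichField {u v : EuclideanSpace ℝ (Fin d) → ℝ}
    {x : EuclideanSpace ℝ (Fin d)} {A B : ℝ} (hu : ContDiffAt ℝ 2 u x) (hv : ContDiffAt ℝ 2 v x)
    (hA : -Laplacian.laplacian u x = A * u x) (hB : -Laplacian.laplacian v x = B * v x) :
    divergence (fun z => rellichField A B z (u z) (gradient u z) (v z) (gradient v z)) x =
      (A + B + (A - B) ^ 2 / 4 * ‖x‖ ^ 2) * (u x * v x) := by
  have du : DifferentiableAt ℝ u x := hu.differentiableAt two_ne_zero
  have dv : DifferentiableAt ℝ v x := hv.differentiableAt two_ne_zero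
  have dgu := differentiableAt_gradient hu
  have dgv := differentiableAt_gradient hv
  have did : DifferentiableAt ℝ (fun z : EuclideanSpace ℝ (Fin d) => z) x := differentiableAt_id
  have dr : DifferentiableAt ℝ (fun z : EuclideanSpace ℝ (Fin d) => (A - B) / 4 * ‖z‖ ^ 2) x :=
    (did.norm_sq ℝ).const_mul _
  have df : DifferentiableAt ℝ
      (fun z => (A + B) / 2 * (u z * v z) - ⟪gradient u z, gradient v z⟫) x :=
    ((du.mul dv).const_mul _).sub (dgu.inner ℝ dgv)
  have dzu : DifferentiableAt ℝ (fun z => ⟪z, gradient u z⟫) x := did.inner ℝ dgu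
  have dzv : DifferentiableAt ℝ (fun z => ⟪z, gradient v z⟫) x := did.inner ℝ dgv
  have d1 : DifferentiableAt ℝ (fun z => v z • gradient u z) x := dv.smul dgu
  have d2 : DifferentiableAt ℝ (fun z => u z • gradient v z) x := du.smul dgv
  have d3 : DifferentiableAt ℝ (fun z => ⟪z, gradient u z⟫ • gradient v z) x := dzu.smul dgv
  have d4 : DifferentiableAt ℝ (fun z => ⟪z, gradient v z⟫ • gradient u z) x := dzv.smul dgu
  have d5 : DifferentiableAt ℝ
      (fun z => ((A + B) / 2 * (u z * v z) - ⟪gradient u z, gradient v z⟫) • z) x := df.smul did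
  have d6 : DifferentiableAt ℝ
      (fun z => ((A - B) / 4 * ‖z‖ ^ 2) • (v z • gradient u z - u z • gradient v z)) x :=
    dr.smul (d1.sub d2)
  have d7 : DifferentiableAt ℝ
      (fun z => (((d : ℝ) - 2) / 2) • (v z • gradient u z + u z • gradient v z)) x :=
    (d1.fun_add d2).fun_const_smul _
  have f3 : ∀ y, fderiv ℝ (fun z => ⟪z, gradient u z⟫) x y =
      ⟪x, fderiv ℝ (gradient u) x y⟫ + ⟪y, gradient u x⟫ := fun y => by
    rw [fderiv_inner_apply ℝ did dgu]; simp
  have f4 : ∀ y, fderiv ℝ (fun z => ⟪z, gradient v z⟫) x y =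
      ⟪x, fderiv ℝ (gradient v) x y⟫ + ⟪y, gradient v x⟫ := fun y => by
    rw [fderiv_inner_apply ℝ did dgv]; simp
  have f5 : ∀ y, fderiv ℝ (fun z => (A + B) / 2 * (u z * v z) - ⟪gradient u z, gradient v z⟫) x y =
      (A + B) / 2 * (u x * ⟪gradient v x, y⟫ + v x * ⟪gradient u x, y⟫) -
        (⟪gradient u x, fderiv ℝ (gradient v) x y⟫ + ⟪fderiv ℝ (gradient u) x y, gradient v x⟫) :=
    fun y => by
      rw [fderiv_fun_sub ((du.fun_mul dv).const_mul _) (dgu.inner ℝ dgv), sub_apply,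
        fderiv_inner_apply ℝ dgu dgv, fderiv_const_mul (du.fun_mul dv), fderiv_fun_mul du dv]
      simp
      ring
  have f6 : ∀ y, fderiv ℝ (fun z : EuclideanSpace ℝ (Fin d) => (A - B) / 4 * ‖z‖ ^ 2) x y =
      (A - B) / 4 * (2 * ⟪x, y⟫) := fun y => by
    rw [fderiv_const_mul (did.norm_sq ℝ), smul_apply, fderiv_norm_sq_apply]
    simp
  have hA' : Laplacian.laplacian u x = -(A * u x) := by linarith
  have hB' : Laplacian.laplacian v x = -(B * v x) := by linarith
  have f7 : ∀ y, fderiv ℝ (fun _ : EuclideanSpace ℝ (Fin d) => ((d : ℝ) - 2) / 2) x y = 0 :=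
    fun y => by simp
  unfold rellichField
  rw [divergence_sub ((d7.fun_add d5).fun_add (d3.fun_add d4)) d6,
    divergence_add (d7.fun_add d5) (d3.fun_add d4), divergence_add d7 d5, divergence_add d3 d4,
    divergence_smul dr (d1.fun_sub d2), divergence_smul (differentiableAt_const _) (d1.fun_add d2),
    divergence_sub d1 d2, divergence_add d1 d2, divergence_smul df did, divergence_id,
    divergence_smul_gradient dv hu, divergence_smul_gradient du hv,
    divergence_smul_gradient dzu hv, divergence_smul_gradient dzv hu, f3, f4, f5, f6, f7,
    fderiv_eq_inner_gradient, fderiv_eq_inner_gradient, hA', hB']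
  have s1 : ⟪x, fderiv ℝ (gradient u) x (gradient v x)⟫ =
      ⟪fderiv ℝ (gradient u) x x, gradient v x⟫ := (inner_fderiv_gradient_comm hu _ _).symm
  have s2 : ⟪x, fderiv ℝ (gradient v) x (gradient u x)⟫ =
      ⟪gradient u x, fderiv ℝ (gradient v) x x⟫ := by
    rw [← inner_fderiv_gradient_comm hv, real_inner_comm]
  rw [s1, s2, inner_sub_right, inner_smul_right, inner_smul_right,
    real_inner_comm (gradient v x) (gradient u x), real_inner_comm x (gradient u x),
    real_inner_comm x (gradient v x)]
  ring

theorem contDiff_rellichField (A B : ℝ) :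
    ContDiff ℝ 1 fun y : EuclideanSpace ℝ (Fin d) × ℝ × EuclideanSpace ℝ (Fin d) × ℝ ×
      EuclideanSpace ℝ (Fin d) => rellichField A B y.1 y.2.1 y.2.2.1 y.2.2.2.1 y.2.2.2.2 := by
  have hz : ContDiff ℝ 1 fun y : EuclideanSpace ℝ (Fin d) × ℝ × EuclideanSpace ℝ (Fin d) × ℝ ×
    EuclideanSpace ℝ (Fin d) => ‖y.1‖ ^ 2 := contDiff_fst.norm_sq ℝ
  have h1 : ContDiff ℝ 1 fun y : EuclideanSpace ℝ (Fin d) × ℝ × EuclideanSpace ℝ (Fin d) × ℝ ×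
      EuclideanSpace ℝ (Fin d) => ⟪y.1, y.2.2.1⟫ :=
    ContDiff.inner ℝ (by fun_prop) (by fun_prop)
  have h2 : ContDiff ℝ 1 fun y : EuclideanSpace ℝ (Fin d) × ℝ × EuclideanSpace ℝ (Fin d) × ℝ ×
      EuclideanSpace ℝ (Fin d) => ⟪y.1, y.2.2.2.2⟫ :=
    ContDiff.inner ℝ (by fun_prop) (by fun_prop)
  have h3 : ContDiff ℝ 1 fun y : EuclideanSpace ℝ (Fin d) × ℝ × EuclideanSpace ℝ (Fin d) × ℝ ×
      EuclideanSpace ℝ (Fin d) => ⟪y.2.2.1, y.2.2.2.2⟫ :=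
    ContDiff.inner ℝ (by fun_prop) (by fun_prop)
  unfold rellichField
  fun_prop

theorem HasBoundaryValue.rellich {u v : EuclideanSpace ℝ (Fin d) → ℝ}
    {f g : EuclideanSpace ℝ (Fin d) → EuclideanSpace ℝ (Fin d)} {s α β : EuclideanSpace ℝ (Fin d)}
    {a b : ℝ} (hu : HasBoundaryValue Ω u s a) (hf : HasBoundaryValue Ω f s α)
    (hv : HasBoundaryValue Ω v s b) (hg : HasBoundaryValue Ω g s β) (A B : ℝ) :
    HasBoundaryValue Ω (fun z => rellichField A B z (u z) (f z) (v z) (g z)) s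
      (rellichField A B s a α b β) := by
  intro r hr
  have l0 : Tendsto (fun z => z) (𝓝[approachRegion Ω r s] s) (𝓝 s) :=
    tendsto_id.mono_left nhdsWithin_le_nhds
  have hl : Tendsto (fun z => (z, u z, f z, v z, g z)) (𝓝[approachRegion Ω r s] s)
      (𝓝 (s, a, α, b, β)) :=
    l0.prodMk_nhds ((hu r hr).prodMk_nhds ((hf r hr).prodMk_nhds ((hv r hr).prodMk_nhds (hg r hr))))
  have hc := (contDiff_rellichField (d := d) A B).continuous
  have hc' := hc.tendsto (s, a, α, b, β)
  have := hc'.comp hl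
  exact this

theorem norm_rellichField_le {A B R : ℝ} {z : EuclideanSpace ℝ (Fin d)} (hz : ‖z‖ ≤ R) (a : ℝ)
    (α : EuclideanSpace ℝ (Fin d)) (b : ℝ) (β : EuclideanSpace ℝ (Fin d)) :
    ‖rellichField A B z a α b β‖ ≤
      (|((d : ℝ) - 2) / 2| + (|(A + B) / 2| + 1) * R + 2 * R + |(A - B) / 4| * R ^ 2) *
        (‖a‖ ^ 2 + ‖α‖ ^ 2 + ‖b‖ ^ 2 + ‖β‖ ^ 2) := by
  set S := ‖a‖ ^ 2 + ‖α‖ ^ 2 + ‖b‖ ^ 2 + ‖β‖ ^ 2 with hS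
  have hR : 0 ≤ R := (norm_nonneg z).trans hz
  have hS0 : 0 ≤ S := by positivity
  have hab : ‖a * b‖ ≤ S := by
    rw [norm_mul]; nlinarith [sq_nonneg (‖a‖ - ‖b‖), sq_nonneg ‖α‖, sq_nonneg ‖β‖]
  have hαβ' : ‖α‖ * ‖β‖ ≤ S := by
    nlinarith [sq_nonneg (‖α‖ - ‖β‖), sq_nonneg ‖a‖, sq_nonneg ‖b‖]
  have hαβ : ‖⟪α, β⟫‖ ≤ S := (norm_inner_le_norm _ _).trans hαβ'
  have h1' : ‖b • α‖ + ‖a • β‖ ≤ S := by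
    rw [norm_smul, norm_smul]
    nlinarith [sq_nonneg (‖b‖ - ‖α‖), sq_nonneg (‖a‖ - ‖β‖)]
  have h1 : ‖b • α + a • β‖ ≤ S := (norm_add_le _ _).trans h1'
  have h2 : ‖b • α - a • β‖ ≤ S := (norm_sub_le _ _).trans h1'
  have h3 : ‖⟪z, α⟫ • β + ⟪z, β⟫ • α‖ ≤ 2 * R * S := by
    refine (norm_add_le _ _).trans ?_
    rw [norm_smul, norm_smul]
    have k1 : ‖⟪z, α⟫‖ ≤ R * ‖α‖ := (norm_inner_le_norm _ _).trans (by gcongr)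
    have k2 : ‖⟪z, β⟫‖ ≤ R * ‖β‖ := (norm_inner_le_norm _ _).trans (by gcongr)
    have k3 := mul_le_mul_of_nonneg_right k1 (norm_nonneg β)
    have k4 := mul_le_mul_of_nonneg_right k2 (norm_nonneg α)
    nlinarith [mul_le_mul_of_nonneg_left hαβ' hR]
  have h4 : ‖((A + B) / 2 * (a * b) - ⟪α, β⟫) • z‖ ≤ (|(A + B) / 2| + 1) * R * S := by
    rw [norm_smul]
    have k1 : ‖(A + B) / 2 * (a * b) - ⟪α, β⟫‖ ≤ (|(A + B) / 2| + 1) * S := by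
      refine (norm_sub_le _ _).trans ?_
      rw [norm_mul, Real.norm_eq_abs ((A + B) / 2), add_mul, one_mul]
      gcongr
    calc _ ≤ (|(A + B) / 2| + 1) * S * R := by gcongr
      _ = _ := by ring
  unfold rellichField
  refine (norm_sub_le _ _).trans ?_
  refine (add_le_add (norm_add₃_le) le_rfl).trans ?_
  rw [norm_smul, norm_smul (((A - B) / 4) * ‖z‖ ^ 2), norm_mul, norm_pow, norm_norm,
    Real.norm_eq_abs, Real.norm_eq_abs]
  have h5 : |(A - B) / 4| * ‖z‖ ^ 2 * ‖b • α - a • β‖ ≤ |(A - B) / 4| * R ^ 2 * S := by gcongr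
  have h6 : |((d : ℝ) - 2) / 2| * ‖b • α + a • β‖ ≤ |((d : ℝ) - 2) / 2| * S := by gcongr
  linarith

theorem inner_rellichField (A B : ℝ) (n z : EuclideanSpace ℝ (Fin d)) (a : ℝ)
    (α : EuclideanSpace ℝ (Fin d)) (b : ℝ) (β : EuclideanSpace ℝ (Fin d)) :
    ⟪n, rellichField A B z a α b β⟫ =
      ((d : ℝ) - 2) / 2 * (⟪n, α⟫ * b + ⟪n, β⟫ * a)
      + ⟪z, n⟫ * ((A + B) / 2 * (a * b) - ⟪α, β⟫) + ⟪z, α⟫ * ⟪n, β⟫ + ⟪z, β⟫ * ⟪n, α⟫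
      - (A - B) / 4 * ‖z‖ ^ 2 * (b * ⟪n, α⟫ - a * ⟪n, β⟫) := by
  unfold rellichField
  simp only [inner_add_right, inner_sub_right, inner_smul_right]
  rw [real_inner_comm n z]
  ring

theorem hasBoundaryValue_boundaryValue {F : Type*} [TopologicalSpace F] [Zero F]
    {f : EuclideanSpace ℝ (Fin d) → F} {s : EuclideanSpace ℝ (Fin d)}
    (h : ∃ y, HasBoundaryValue Ω f s y) : HasBoundaryValue Ω f s (boundaryValue Ω f s) := by
  rw [boundaryValue, dif_pos h]
  exact h.choose_spec

section Rellich

variable {u v : EuclideanSpace ℝ (Fin d) → ℝ}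

/-- A function controlled by squares of functions regular up to the boundary has integrable
nontangential maximal functions. -/
theorem lintegral_maximalFn_lt_top_of_le_sq {F : Type*} [NormedAddCommGroup F]
    {f : EuclideanSpace ℝ (Fin d) → F} {C : ℝ} (hC : 0 ≤ C)
    (hu : RegularUpToBoundary Ω u) (hgu : RegularUpToBoundary Ω (gradient u))
    (hv : RegularUpToBoundary Ω v) (hgv : RegularUpToBoundary Ω (gradient v))
    (hf : ∀ x ∈ Ω, ‖f x‖ ≤ C * (‖u x‖ ^ 2 + ‖gradient u x‖ ^ 2 + ‖v x‖ ^ 2 + ‖gradient v x‖ ^ 2))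
    {a : ℝ} (ha : 0 < a) : ∫⁻ s, maximalFn Ω a f s ∂(surfaceMeasure Ω) < ⊤ := by
  set N : EuclideanSpace ℝ (Fin d) → ℝ≥0∞ := fun s => maximalFn Ω a u s ^ 2 +
    maximalFn Ω a (gradient u) s ^ 2 + maximalFn Ω a v s ^ 2 + maximalFn Ω a (gradient v) s ^ 2
  have hle : ∀ s, maximalFn Ω a f s ≤ ENNReal.ofReal C * N s := by
    intro s
    refine iSup₂_le fun x hx => ?_
    have h1 : ‖f x‖ₑ ≤ ENNReal.ofReal
        (C * (‖u x‖ ^ 2 + ‖gradient u x‖ ^ 2 + ‖v x‖ ^ 2 + ‖gradient v x‖ ^ 2)) := by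
      rw [← ofReal_norm]
      exact ENNReal.ofReal_le_ofReal (hf x hx.1)
    refine h1.trans ?_
    rw [ENNReal.ofReal_mul hC, ENNReal.ofReal_add (by positivity) (by positivity),
      ENNReal.ofReal_add (by positivity) (by positivity),
      ENNReal.ofReal_add (by positivity) (by positivity),
      ENNReal.ofReal_pow (norm_nonneg _), ENNReal.ofReal_pow (norm_nonneg _),
      ENNReal.ofReal_pow (norm_nonneg _), ENNReal.ofReal_pow (norm_nonneg _),
      ofReal_norm, ofReal_norm, ofReal_norm, ofReal_norm]
    have k1 := enorm_le_maximalFn (f := u) hx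
    have k2 := enorm_le_maximalFn (f := gradient u) hx
    have k3 := enorm_le_maximalFn (f := v) hx
    have k4 := enorm_le_maximalFn (f := gradient v) hx
    simp only [N]
    gcongr
  refine (lintegral_mono hle).trans_lt ?_
  have m1 : Measurable fun s => maximalFn Ω a u s ^ 2 := measurable_maximalFn.pow_const 2
  have m2 : Measurable fun s => maximalFn Ω a (gradient u) s ^ 2 :=
    measurable_maximalFn.pow_const 2
  have m3 : Measurable fun s => maximalFn Ω a v s ^ 2 := measurable_maximalFn.pow_const 2
  have m12 := m1.add m2
  have m123 := m12.add m3
  rw [lintegral_const_mul' _ _ ENNReal.ofReal_ne_top]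
  simp only [Pi.add_def] at m12 m123
  simp only [N]
  rw [lintegral_add_left m123, lintegral_add_left m12, lintegral_add_left m1]
  refine ENNReal.mul_lt_top ENNReal.ofReal_lt_top ?_
  simp only [ENNReal.add_lt_top]
  exact ⟨⟨⟨hu.maximal a ha, hgu.maximal a ha⟩, hv.maximal a ha⟩, hgv.maximal a ha⟩

/-- The boundary form of two eigenfunctions satisfying the same boundary conditions, as an
integral over the domain. -/
theorem IsLipschitzDomain.rellich_identity (hΩ : IsLipschitzDomain Ω) {A B : ℝ}
    (hu : ContDiffOn ℝ 2 u Ω) (hv : ContDiffOn ℝ 2 v Ω)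
    (ru : RegularUpToBoundary Ω u) (rgu : RegularUpToBoundary Ω (gradient u))
    (rv : RegularUpToBoundary Ω v) (rgv : RegularUpToBoundary Ω (gradient v))
    (hA : ∀ x ∈ Ω, -Laplacian.laplacian u x = A * u x)
    (hB : ∀ x ∈ Ω, -Laplacian.laplacian v x = B * v x)
    (hbc : ∀ᵐ s ∂(surfaceMeasure Ω), boundaryValue Ω v s * normalDeriv Ω u s =
      boundaryValue Ω u s * normalDeriv Ω v s) :
    Integrable (qIntegrand Ω u v (A + B)) (surfaceMeasure Ω) ∧
    IntegrableOn (fun x => u x * v x) Ω ∧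
    q Ω u v (A + B) = ∫ x in Ω, (A + B + (A - B) ^ 2 / 4 * ‖x‖ ^ 2) * (u x * v x) := by
  obtain ⟨R, hR0, hR⟩ := hΩ.isBounded.exists_pos_norm_le
  have hu' : ∀ x ∈ Ω, ContDiffAt ℝ 2 u x := fun x hx => hu.contDiffAt (hΩ.isOpen.mem_nhds hx)
  have hv' : ∀ x ∈ Ω, ContDiffAt ℝ 2 v x := fun x hx => hv.contDiffAt (hΩ.isOpen.mem_nhds hx)
  set W := fun z => rellichField A B z (u z) (gradient u z) (v z) (gradient v z) with hWdef
  set w := fun s => rellichField A B s (boundaryValue Ω u s) (bdryGrad Ω u s)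
    (boundaryValue Ω v s) (bdryGrad Ω v s) with hwdef
  have hWc : ContDiffOn ℝ 1 W Ω := by
    intro x hx
    have c1 := (hu' x hx).of_le (show (1 : WithTop ℕ∞) ≤ 2 by norm_num)
    have c2 := (hv' x hx).of_le (show (1 : WithTop ℕ∞) ≤ 2 by norm_num)
    have c3 := contDiffAt_gradient (hu' x hx)
    have c4 := contDiffAt_gradient (hv' x hx)
    have c0 : ContDiffAt ℝ 1 (fun z : EuclideanSpace ℝ (Fin d) => z) x := contDiffAt_id
    exact ((contDiff_rellichField A B).contDiffAt.comp x
      (c0.prodMk (c1.prodMk (c3.prodMk (c2.prodMk c4))))).contDiffWithinAt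
  have hw : ∀ᵐ s ∂(surfaceMeasure Ω), HasBoundaryValue Ω W s (w s) := by
    filter_upwards [ru.hasBoundaryValue, rgu.hasBoundaryValue, rv.hasBoundaryValue,
      rgv.hasBoundaryValue] with s h1 h2 h3 h4
    exact (hasBoundaryValue_boundaryValue h1).rellich (hasBoundaryValue_boundaryValue h2)
      (hasBoundaryValue_boundaryValue h3) (hasBoundaryValue_boundaryValue h4) A B
  have hN : ∀ a > 0, ∫⁻ s, maximalFn Ω a W s ∂(surfaceMeasure Ω) < ⊤ := fun a ha =>
    lintegral_maximalFn_lt_top_of_le_sq (by positivity) ru rgu rv rgv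
      (fun x hx => norm_rellichField_le (hR x hx) _ _ _ _) ha
  have huv : IntegrableOn (fun x => u x * v x) Ω := by
    refine hΩ.integrableOn (hu.continuousOn.mul hv.continuousOn) fun a ha =>
      lintegral_maximalFn_lt_top_of_le_sq zero_le_one ru rgu rv rgv (fun x hx => ?_) ha
    rw [norm_mul]
    nlinarith [sq_nonneg (‖u x‖ - ‖v x‖), sq_nonneg ‖gradient u x‖, sq_nonneg ‖gradient v x‖]
  have hdivW : ∀ x ∈ Ω, divergence W x = (A + B + (A - B) ^ 2 / 4 * ‖x‖ ^ 2) * (u x * v x) :=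
    fun x hx => divergence_rellichField (hu' x hx) (hv' x hx) (hA x hx) (hB x hx)
  have hdivi : IntegrableOn (fun x => (A + B + (A - B) ^ 2 / 4 * ‖x‖ ^ 2) * (u x * v x)) Ω := by
    refine huv.bdd_mul (c := |A + B| + (A - B) ^ 2 / 4 * R ^ 2)
      (Continuous.aestronglyMeasurable (by fun_prop)) ?_
    refine (ae_restrict_iff' hΩ.isOpen.measurableSet).2 (ae_of_all _ fun x hx => ?_)
    refine (norm_add_le _ _).trans (add_le_add le_rfl ?_)
    rw [Real.norm_of_nonneg (by positivity)]
    have := hR x hx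
    gcongr
  have hfl := hΩ.integrable_flux hWc.continuousOn hw hN
  have hdt := hΩ.integral_divergence hWc hw hN
    (hdivi.congr_fun (fun x hx => (hdivW x hx).symm) hΩ.isOpen.measurableSet)
  have hq : (fun s => ⟪outwardNormal Ω s, w s⟫) =ᵐ[surfaceMeasure Ω]
      qIntegrand Ω u v (A + B) := by
    filter_upwards [hbc] with s hs
    rw [hwdef, inner_rellichField]
    unfold qIntegrand radialDeriv
    unfold normalDeriv at hs ⊢
    rw [hs, sub_self, mul_zero, sub_zero]
  refine ⟨hfl.congr hq, huv, ?_⟩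
  rw [q, ← integral_congr_ae hq, ← hdt, setIntegral_congr_fun hΩ.isOpen.measurableSet hdivW]

end Rellich

end QuasiOrth

namespace QuasiOrth

open scoped ENNReal NNReal RealInnerProductSpace

section OperatorNorm

open scoped Matrix.Norms.L2Operator

variable {n : Type*} [Fintype n] [DecidableEq n]

theorem l2_opNorm_le_of_bilinear_le {M : Matrix n n ℝ} {C : ℝ} (hC : 0 ≤ C)
    (h : ∀ x y : n → ℝ, ∑ i, ∑ j, x i * y j * M i j ≤ C / 2 * (∑ i, x i ^ 2 + ∑ i, y i ^ 2)) :
    ‖M‖ ≤ C := by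
  rw [← Matrix.l2_opNorm_toEuclideanCLM]
  set T := Matrix.toEuclideanCLM (n := n) (𝕜 := ℝ) M
  have hT : ∀ x y : EuclideanSpace ℝ n, ⟪x, T y⟫ ≤ C / 2 * (‖x‖ ^ 2 + ‖y‖ ^ 2) := by
    intro x y
    refine le_of_eq_of_le ?_ ((h x.ofLp y.ofLp).trans_eq ?_)
    · rw [PiLp.inner_apply]
      refine Finset.sum_congr rfl fun i _ => ?_
      have : (T y) i = ∑ j, M i j * y j := rfl
      rw [this, real_inner_comm, real_inner_eq_re_inner]
      simp only [RCLike.inner_apply, conj_trivial, RCLike.re_to_real, Finset.mul_sum]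
      refine Finset.sum_congr rfl fun j _ => by ring
    · rw [EuclideanSpace.real_norm_sq_eq, EuclideanSpace.real_norm_sq_eq]
  refine ContinuousLinearMap.opNorm_le_bound _ hC fun y => ?_
  rcases eq_or_ne (T y) 0 with h0 | h0
  · rw [h0, norm_zero]; positivity
  have hTy : 0 < ‖T y‖ := norm_pos_iff.2 h0
  have hy : 0 < ‖y‖ := norm_pos_iff.2 fun hy => h0 (by rw [hy, map_zero])
  have key := hT ((‖y‖ / ‖T y‖) • T y) y
  rw [inner_smul_left, real_inner_self_eq_norm_sq, norm_smul, norm_div, norm_norm, norm_norm,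
    div_mul_cancel₀ _ hTy.ne'] at key
  simp only [conj_trivial] at key
  have e : ‖y‖ / ‖T y‖ * ‖T y‖ ^ 2 = ‖y‖ * ‖T y‖ := by field_simp
  rw [e] at key
  have : ‖y‖ * ‖T y‖ ≤ ‖y‖ * (C * ‖y‖) := by linarith
  exact le_of_mul_le_mul_left this hy

theorem l2_opNorm_diagonal_le {a : n → ℝ} {w : ℝ} (hw : 0 ≤ w) (ha : ∀ i, |a i| ≤ w) :
    ‖Matrix.diagonal a‖ ≤ w := by
  rw [Matrix.l2_opNorm_diagonal]
  exact (pi_norm_le_iff_of_nonneg hw).2 ha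

/-- A matrix with entries `(a i - a j)² M i j` is small when the `a i` are small. -/
theorem l2_opNorm_sq_sub_mul_le {M : Matrix n n ℝ} {a : n → ℝ} {w C : ℝ} (hw : 0 ≤ w)
    (ha : ∀ i, |a i| ≤ w) (hM : ‖M‖ ≤ C) :
    ‖(Matrix.of fun i j => (a i - a j) ^ 2 * M i j : Matrix n n ℝ)‖ ≤ 4 * w ^ 2 * C := by
  set D := Matrix.diagonal a
  have hD : ‖D‖ ≤ w := l2_opNorm_diagonal_le hw ha
  have hC : 0 ≤ C := (norm_nonneg _).trans hM
  have e : (Matrix.of fun i j => (a i - a j) ^ 2 * M i j : Matrix n n ℝ) =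
      D * (D * M) - (2 : ℝ) • (D * M * D) + M * D * D := by
    ext i j
    simp only [D, Matrix.of_apply, Matrix.add_apply, Matrix.sub_apply, Matrix.smul_apply,
      Matrix.diagonal_mul, Matrix.mul_diagonal, smul_eq_mul]
    ring
  have h1 : ‖D * (D * M)‖ ≤ w * (w * C) :=
    (norm_mul_le _ _).trans (mul_le_mul hD ((norm_mul_le _ _).trans
      (mul_le_mul hD hM (norm_nonneg _) hw)) (norm_nonneg _) hw)
  have h2 : ‖D * M * D‖ ≤ w * C * w :=
    (norm_mul_le _ _).trans (mul_le_mul ((norm_mul_le _ _).trans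
      (mul_le_mul hD hM (norm_nonneg _) hw)) hD (norm_nonneg _) (mul_nonneg hw hC))
  have h3 : ‖M * D * D‖ ≤ C * w * w :=
    (norm_mul_le _ _).trans (mul_le_mul ((norm_mul_le _ _).trans
      (mul_le_mul hM hD (norm_nonneg _) hC)) hD (norm_nonneg _) (mul_nonneg hC hw))
  rw [e]
  refine (norm_add_le _ _).trans ((add_le_add (norm_sub_le _ _) le_rfl).trans ?_)
  rw [norm_smul, Real.norm_ofNat]
  linarith

end OperatorNorm

variable {d : ℕ} {Ω ΓD : Set (EuclideanSpace ℝ (Fin d))} {γ : EuclideanSpace ℝ (Fin d) → ℝ}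
  {E : ℕ → ℝ} {φ : ℕ → EuclideanSpace ℝ (Fin d) → ℝ}

/-- The matrix elements of multiplication by `‖x‖²`. -/
noncomputable def moment (Ω : Set (EuclideanSpace ℝ (Fin d)))
    (φ : ℕ → EuclideanSpace ℝ (Fin d) → ℝ) (i j : ℕ) : ℝ :=
  ∫ x in Ω, ‖x‖ ^ 2 * (φ i x * φ j x)

theorem IsEigenSystem.boundary_condition (h : IsEigenSystem Ω ΓD γ E φ) (i j : ℕ) :
    ∀ᵐ s ∂(surfaceMeasure Ω), boundaryValue Ω (φ j) s * normalDeriv Ω (φ i) s =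
      boundaryValue Ω (φ i) s * normalDeriv Ω (φ j) s := by
  filter_upwards [h.dirichlet i, h.dirichlet j, h.robin i, h.robin j] with s d1 d2 r1 r2
  by_cases hs : s ∈ ΓD
  · rw [d1 hs, d2 hs, zero_mul, zero_mul]
  · linear_combination boundaryValue Ω (φ j) s * r1 hs - boundaryValue Ω (φ i) s * r2 hs

theorem IsEigenSystem.rellich (h : IsEigenSystem Ω ΓD γ E φ) (hΩ : IsLipschitzDomain Ω)
    (i j : ℕ) :
    Integrable (qIntegrand Ω (φ i) (φ j) (E i + E j)) (surfaceMeasure Ω) ∧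
    IntegrableOn (fun x => φ i x * φ j x) Ω ∧
    Q Ω E φ i j = ∫ x in Ω, (E i + E j + (E i - E j) ^ 2 / 4 * ‖x‖ ^ 2) * (φ i x * φ j x) :=
  hΩ.rellich_identity (h.contDiffOn i) (h.contDiffOn j) (h.regular i) (h.regular_gradient i)
    (h.regular j) (h.regular_gradient j) (h.eigen i) (h.eigen j) (h.boundary_condition i j)

theorem integrableOn_norm_sq_mul (hΩ : IsLipschitzDomain Ω) {f : EuclideanSpace ℝ (Fin d) → ℝ}
    (hf : IntegrableOn f Ω) : IntegrableOn (fun x => ‖x‖ ^ 2 * f x) Ω := by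
  obtain ⟨R, hR0, hR⟩ := hΩ.isBounded.exists_pos_norm_le
  refine hf.bdd_mul (c := R ^ 2) (Continuous.aestronglyMeasurable (by fun_prop)) ?_
  refine (ae_restrict_iff' hΩ.isOpen.measurableSet).2 (ae_of_all _ fun x hx => ?_)
  rw [norm_pow, norm_norm]
  have := hR x hx
  gcongr

theorem IsEigenSystem.Q_eq (h : IsEigenSystem Ω ΓD γ E φ) (hΩ : IsLipschitzDomain Ω) (i j : ℕ) :
    Q Ω E φ i j = (if i = j then 2 * E i else 0) + (E i - E j) ^ 2 / 4 * moment Ω φ i j := by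
  obtain ⟨-, h2, h3⟩ := h.rellich hΩ i j
  have e : ∀ x, (E i + E j + (E i - E j) ^ 2 / 4 * ‖x‖ ^ 2) * (φ i x * φ j x) =
      (E i + E j) * (φ i x * φ j x) + (E i - E j) ^ 2 / 4 * (‖x‖ ^ 2 * (φ i x * φ j x)) :=
    fun x => by ring
  rw [h3]
  simp_rw [e]
  rw [integral_add (h2.const_mul _) ((integrableOn_norm_sq_mul hΩ h2).const_mul _),
    integral_const_mul, integral_const_mul, h.orthonormal, moment]
  split_ifs with hij
  · subst hij; ring
  · ring

theorem IsEigenSystem.moment_bilinear_le (h : IsEigenSystem Ω ΓD γ E φ) (hΩ : IsLipschitzDomain Ω)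
    {R : ℝ} (hR : ∀ x ∈ Ω, ‖x‖ ≤ R) (S : Finset ℕ) (x y : S → ℝ) :
    ∑ i, ∑ j, x i * y j * moment Ω φ i j ≤ R ^ 2 / 2 * (∑ i, x i ^ 2 + ∑ i, y i ^ 2) := by
  have hint : ∀ i j : S, IntegrableOn (fun x => φ i x * φ j x) Ω := fun i j =>
    (h.rellich hΩ i j).2.1
  have hexp : ∀ a b : S → ℝ, ∀ z, (∑ i : S, a i * φ i z) * (∑ j : S, b j * φ j z) =
      ∑ i : S, ∑ j : S, a i * b j * (φ i z * φ j z) := fun a b z => by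
    rw [Finset.sum_mul_sum]
    exact Finset.sum_congr rfl fun i _ => Finset.sum_congr rfl fun j _ => by ring
  have hprod : ∀ a b : S → ℝ,
      IntegrableOn (fun z => (∑ i : S, a i * φ i z) * (∑ j : S, b j * φ j z)) Ω := by
    intro a b
    simp_rw [hexp]
    exact integrable_finsetSum _ fun i _ => integrable_finsetSum _ fun j _ =>
      (hint i j).const_mul _
  have hsq : ∀ a : S → ℝ,
      ∫ z in Ω, (∑ i : S, a i * φ i z) * (∑ j : S, a j * φ j z) = ∑ i, a i ^ 2 := by
    intro a
    simp_rw [hexp]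
    rw [integral_finsetSum _ fun i _ => integrable_finsetSum _ fun j _ => (hint i j).const_mul _]
    refine Finset.sum_congr rfl fun i _ => ?_
    rw [integral_finsetSum _ fun j _ => (hint i j).const_mul _]
    simp_rw [integral_const_mul, h.orthonormal]
    simp [sq]
  have hlhs : ∑ i, ∑ j, x i * y j * moment Ω φ i j =
      ∫ z in Ω, ‖z‖ ^ 2 * ((∑ i : S, x i * φ i z) * (∑ j : S, y j * φ j z)) := by
    have e : ∀ z, ‖z‖ ^ 2 * ((∑ i : S, x i * φ i z) * (∑ j : S, y j * φ j z)) =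
        ∑ i : S, ∑ j : S, x i * y j * (‖z‖ ^ 2 * (φ i z * φ j z)) := fun z => by
      rw [hexp, Finset.mul_sum]
      refine Finset.sum_congr rfl fun i _ => ?_
      rw [Finset.mul_sum]
      exact Finset.sum_congr rfl fun j _ => by ring
    have hm := fun i j : S => integrableOn_norm_sq_mul hΩ (hint i j)
    simp_rw [e]
    rw [integral_finsetSum _ fun i _ => integrable_finsetSum _ fun j _ => (hm i j).const_mul _]
    refine Finset.sum_congr rfl fun i _ => ?_
    rw [integral_finsetSum _ fun j _ => (hm i j).const_mul _]
    refine Finset.sum_congr rfl fun j _ => ?_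
    rw [integral_const_mul, moment]
  rw [hlhs, ← hsq x, ← hsq y, ← integral_add (hprod x x) (hprod y y), ← integral_const_mul]
  refine setIntegral_mono_on (integrableOn_norm_sq_mul hΩ (hprod x y))
    (((hprod x x).add (hprod y y)).const_mul _) hΩ.isOpen.measurableSet fun z hz => ?_
  set f := ∑ i : S, x i * φ i z
  set g := ∑ i : S, y i * φ i z
  have h1 : ‖z‖ ^ 2 ≤ R ^ 2 := by have := hR z hz; gcongr
  have h2 : f * g ≤ (f * f + g * g) / 2 := by nlinarith [sq_nonneg (f - g)]
  have h3 : 0 ≤ (f * f + g * g) / 2 := by nlinarith [mul_self_nonneg f, mul_self_nonneg g]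
  calc ‖z‖ ^ 2 * (f * g) ≤ ‖z‖ ^ 2 * ((f * f + g * g) / 2) := by gcongr
    _ ≤ R ^ 2 * ((f * f + g * g) / 2) := by gcongr
    _ = _ := by ring

theorem IsEigenSystem.abs_moment_le (h : IsEigenSystem Ω ΓD γ E φ) (hΩ : IsLipschitzDomain Ω)
    {R : ℝ} (hR : ∀ x ∈ Ω, ‖x‖ ≤ R) (i j : ℕ) : |moment Ω φ i j| ≤ R ^ 2 := by
  have hint := fun i j => (h.rellich hΩ i j).2.1
  have hi : ∫ x in Ω, φ i x * φ i x = 1 := by simp [h.orthonormal]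
  have hj : ∫ x in Ω, φ j x * φ j x = 1 := by simp [h.orthonormal]
  have hR2 : R ^ 2 = ∫ x in Ω, R ^ 2 / 2 * (φ i x * φ i x + φ j x * φ j x) := by
    rw [integral_const_mul, integral_add (hint i i) (hint j j), hi, hj]; ring
  rw [moment, ← Real.norm_eq_abs, hR2]
  refine norm_integral_le_of_norm_le (((hint i i).add (hint j j)).const_mul _) ?_
  refine (ae_restrict_iff' hΩ.isOpen.measurableSet).2 (ae_of_all _ fun z hz => ?_)
  have h1 : ‖z‖ ^ 2 ≤ R ^ 2 := by have := hR z hz; gcongr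
  have h2 : |φ i z * φ j z| ≤ (φ i z * φ i z + φ j z * φ j z) / 2 := by
    rw [abs_mul]
    nlinarith [sq_nonneg (|φ i z| - |φ j z|), abs_mul_abs_self (φ i z), abs_mul_abs_self (φ j z)]
  rw [norm_mul, norm_pow, norm_norm, Real.norm_eq_abs]
  calc ‖z‖ ^ 2 * |φ i z * φ j z| ≤ R ^ 2 * ((φ i z * φ i z + φ j z * φ j z) / 2) :=
        mul_le_mul h1 h2 (abs_nonneg _) (sq_nonneg _)
    _ = _ := by ring

/-- The window submatrix of the boundary form, divided by `2 en`, differs from the identity by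
`O(w / en + w² / en)`. -/
theorem IsEigenSystem.norm_subMat_sub_one_le (h : IsEigenSystem Ω ΓD γ E φ)
    (hΩ : IsLipschitzDomain Ω) {R : ℝ} (hR : ∀ x ∈ Ω, ‖x‖ ≤ R) {en w : ℝ} (hen : 0 < en)
    (hw : 0 ≤ w) {S : Finset ℕ} (hS : (S : Set ℕ) ⊆ window E en w) :
    ‖Matrix.toEuclideanCLM (n := S) (𝕜 := ℝ) ((2 * en)⁻¹ • subMat (Q Ω E φ) S - 1)‖ ≤
      w / en + w ^ 2 * R ^ 2 / (2 * en) := by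
  open scoped Matrix.Norms.L2Operator in
  rw [Matrix.l2_opNorm_toEuclideanCLM]
  set a : S → ℝ := fun i => E i - en with ha
  have haw : ∀ i, |a i| ≤ w := fun i => by
    have := hS i.2
    rw [abs_le]
    constructor
    · linarith [this.1]
    · linarith [this.2]
  set M : Matrix S S ℝ := Matrix.of fun i j => moment Ω φ i j
  have hM : ‖M‖ ≤ R ^ 2 :=
    l2_opNorm_le_of_bilinear_le (sq_nonneg R) (h.moment_bilinear_le hΩ hR S)
  have e : (2 * en)⁻¹ • subMat (Q Ω E φ) S - 1 = en⁻¹ • Matrix.diagonal a +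
      (8 * en)⁻¹ • (Matrix.of fun i j => (a i - a j) ^ 2 * M i j : Matrix S S ℝ) := by
    ext i j
    simp only [subMat, Matrix.sub_apply, Matrix.add_apply, Matrix.smul_apply, Matrix.of_apply,
      smul_eq_mul, h.Q_eq hΩ, Matrix.diagonal_apply, Matrix.one_apply, M, ha, Subtype.coe_inj]
    split_ifs with hij
    · subst hij; field_simp; ring
    · field_simp; ring
  rw [e]
  refine (norm_add_le _ _).trans ?_
  rw [norm_smul, norm_smul, norm_inv, norm_inv, Real.norm_of_nonneg hen.le,
    Real.norm_of_nonneg (by positivity : 0 ≤ 8 * en)]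
  have h1 := l2_opNorm_diagonal_le hw haw
  have h2 := l2_opNorm_sq_sub_mul_le hw haw hM
  calc _ ≤ en⁻¹ * w + (8 * en)⁻¹ * (4 * w ^ 2 * R ^ 2) := by gcongr
    _ = _ := by field_simp; ring

end QuasiOrth

theorem corollary1 {d : ℕ} (hd : 2 ≤ d) (Ω : Set (EuclideanSpace ℝ (Fin d)))
    (hΩ : QuasiOrth.IsLipschitzDomain Ω) (β : ℝ) (hβ : β < 1 / 2) (K : ℝ) :
    ∃ c : ℝ, ∀ (ΓD : Set (EuclideanSpace ℝ (Fin d))) (γ : EuclideanSpace ℝ (Fin d) → ℝ)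
      (E : ℕ → ℝ) (φ : ℕ → EuclideanSpace ℝ (Fin d) → ℝ),
      QuasiOrth.IsEigenSystem Ω ΓD γ E φ →
      ∀ ε₀ : ℝ → ℝ, Asymptotics.IsBigOWith K atTop ε₀ (fun en => en ^ β) →
        -- the boundary integrals that define `Q` converge
        (∀ i j, Integrable (QuasiOrth.qIntegrand Ω (φ i) (φ j) (E i + E j))
          (QuasiOrth.surfaceMeasure Ω)) ∧
        -- the window submatrix divided by `2 en` tends to the identity, in operator norm
        (∀ η > (0 : ℝ), ∀ᶠ en in atTop, ∀ S : Finset ℕ,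
          (S : Set ℕ) ⊆ QuasiOrth.window E en (ε₀ en) →
          ‖Matrix.toEuclideanCLM (n := S) (𝕜 := ℝ)
            ((2 * en)⁻¹ • QuasiOrth.subMat (QuasiOrth.Q Ω E φ) S - 1)‖ < η) ∧
        -- the bound on the off-diagonal entries, wherever the window has width at most `K en ^ β`
        (∀ en > (0 : ℝ), ε₀ en ≤ K * en ^ β →
          ∀ i ∈ QuasiOrth.window E en (ε₀ en), ∀ j ∈ QuasiOrth.window E en (ε₀ en), i ≠ j →
            |QuasiOrth.Q Ω E φ i j / (2 * en)| ≤ c * en ^ (2 * β - 1)) := by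
  obtain ⟨R, hR0, hR⟩ := hΩ.isBounded.exists_pos_norm_le
  refine ⟨K ^ 2 * R ^ 2 / 2, fun ΓD γ E φ h ε₀ hε => ⟨fun i j => (h.rellich hΩ i j).1, ?_, ?_⟩⟩
  · intro η hη
    have hlim : Tendsto (fun en : ℝ => K * en ^ (β - 1) + K ^ 2 * R ^ 2 / 2 * en ^ (2 * β - 1))
        atTop (𝓝 (K * 0 + K ^ 2 * R ^ 2 / 2 * 0)) := by
      have h1 : Tendsto (fun en : ℝ => en ^ (β - 1)) atTop (𝓝 0) := by
        have := tendsto_rpow_neg_atTop (y := 1 - β) (by linarith)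
        rwa [neg_sub] at this
      have h2 : Tendsto (fun en : ℝ => en ^ (2 * β - 1)) atTop (𝓝 0) := by
        have := tendsto_rpow_neg_atTop (y := 1 - 2 * β) (by linarith)
        rwa [neg_sub] at this
      exact (h1.const_mul _).add (h2.const_mul _)
    rw [mul_zero, mul_zero, add_zero] at hlim
    filter_upwards [hlim.eventually (gt_mem_nhds hη), hε.bound, eventually_gt_atTop 0]
      with en hen hb hpos S hS
    refine lt_of_le_of_lt ?_ hen
    have hp : 0 < en ^ β := Real.rpow_pos_of_pos hpos β
    rw [Real.norm_of_nonneg hp.le, Real.norm_eq_abs] at hb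
    have hw : 0 ≤ K * en ^ β := (abs_nonneg _).trans hb
    have hle : ε₀ en ≤ K * en ^ β := (le_abs_self _).trans hb
    have hS' : (S : Set ℕ) ⊆ QuasiOrth.window E en (K * en ^ β) := fun i hi =>
      ⟨by linarith [(hS hi).1], by linarith [(hS hi).2]⟩
    refine (h.norm_subMat_sub_one_le hΩ hR hpos hw hS').trans_eq ?_
    rw [show 2 * β - 1 = β + β - 1 by ring, Real.rpow_sub hpos, Real.rpow_sub hpos,
      Real.rpow_add hpos, Real.rpow_one]
    field_simp
  · intro en hpos hle i hi j hj hij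
    have hp : 0 < en ^ β := Real.rpow_pos_of_pos hpos β
    have hab : |E i - E j| ≤ 2 * (K * en ^ β) := by
      rw [abs_le]
      constructor <;> linarith [hi.1, hi.2, hj.1, hj.2]
    have hsq : (E i - E j) ^ 2 ≤ (2 * (K * en ^ β)) ^ 2 := by
      rw [← sq_abs]; gcongr
    rw [h.Q_eq hΩ, if_neg hij, zero_add, abs_div, abs_mul, abs_of_nonneg (by positivity),
      abs_of_pos (by positivity : 0 < 2 * en), div_le_iff₀ (by positivity)]
    calc (E i - E j) ^ 2 / 4 * |QuasiOrth.moment Ω φ i j|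
        ≤ (2 * (K * en ^ β)) ^ 2 / 4 * R ^ 2 := by
          gcongr
          exact h.abs_moment_le hΩ hR i j
      _ = K ^ 2 * R ^ 2 / 2 * en ^ (2 * β - 1) * (2 * en) := by
          rw [show 2 * β - 1 = β + β - 1 by ring, Real.rpow_sub hpos, Real.rpow_add hpos,
            Real.rpow_one]
          field_simp
          norm_num [mul_comm]
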